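/- Let $k$ be an infinite field, let $Q=k[x_1,\dots,x_\nu]$ be graded with variables of positive degree, and let $R=Q/(f_1,\dots,f_c)$, where $f_1,\dots,f_c\in(x_1,\dots,x_\nu)^2$ is a $Q$-regular sequence of homogeneous elements, $\deg f_m=e_m$. Let $M$ and $N$ be finitely generated $\mathbb Z$-graded $R$-modules. For a graded module $L$ put $L(a)_i=L_{a+i}$, and let $H(L,t)=\sum_i\dim_k(L_i)\,t^i$ be its Hilbert series. Let $$\rho^j_R(M,N)(t)=\sum_{i=0}^j(-1)^iH(\operatorname{Ext}^i_R(M,N),t)-\frac{H(M,t^{-1})\,H(N,t)}{H(R,t^{-1})}\qquad(j\ge 0).$$ Let $\lambda$ denote length, and let $\ell=\inf\{m\in\mathbb Z\mid \lambda(\operatorname{Ext}^i_R(M,N))<\infty\text{ for all }i>m\}$. Assume that $\ell<\infty$ and that the complexity $$\operatorname{cx}_R(M,N)=\inf\{b\in\mathbb N\mid \lambda(\operatorname{Ext}^i_R(M,N))\le a\,i^{b-1}\text{ for some }a\in\mathbb R\text{ and all }i\gg0\}$$ is positive. Let $(F,\partial)$ be a minimal graded free resolution of $M$ over $R$, and put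 $\operatorname{Syz}_i=\operatorname{Coker}(\partial_{i+1})$. Choose a graded lifting $(\widetilde F,\widetilde\partial)$ of $(F,\partial)$ to $Q$ and homogeneous maps $\widetilde\tau^m_j\colon\widetilde F_{j+2}\to\widetilde F_j(-e_m)$ with $\widetilde\partial^2=\sum_m f_m\widetilde\tau^m$; the Eisenbud operators are $\tau^m=\widetilde\tau^m\otimes_QR$, and they induce maps $\chi_m\colon\operatorname{Ext}^j_R(M,N)(e_m)\to\operatorname{Ext}^{j+2}_R(M,N)$. Let $e,s\ge0$ be integers and let $a_m\in R_{e_m-e}$ be such that $\chi=\sum_m a_m\chi_m$ (of bidegree $(2,-e)$) is a non-zerodivisor on $\operatorname{Ext}^{\ge s}_R(M,N)$, that is, multiplication by $\chi$ is injective on $\operatorname{Ext}^j_R(M,N)$ for all $j\ge s$. If $\operatorname{cx}_R(M,N)=1$, assume also that $\lambda(\operatorname{Ext}^i_R(M,N))=\lambda(\operatorname{Ext}^{i+2}_R(M,N))$ for all $i\ge s$. Let $n>\max\{s,\ell\}$, and let $K$ be the graded $R$-module that is the pushout of the map $\operatorname{Syz}_{n+2}\to F_{n+1}$ induced by $\partial_{n+2}$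 and the map $\operatorname{Syz}_{n+2}\to\operatorname{Syz}_n(-e)$ induced by $\tau=\sum_m a_m\tau^m$. Then the Hilbert series of $R$, $M$, $N$, $K$ and of all the modules $\operatorname{Ext}^i_R(M,N)$ and $\operatorname{Ext}^i_R(K,N)$ are (expansions at $t=0$ of) rational functions, and there is an equality of rational functions $$\rho^1_R(K,N)(t)=(-1)^n(t^{-e}-1)\,\rho^n_R(M,N)(t)+H(\operatorname{Ext}^{n+1}_R(M,N),t)-H(\operatorname{Ext}^{n+2}_R(M,N),t).$$ -/

import Mathlib

noncomputable section

namespace GradedExt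

/-! ### Graded modules and Hilbert series -/

section Hilbert

variable {k : Type*} [Field k]

/-- `M = ⨁ i, ℳ i` is a `ℤ`-graded module over the `ℤ`-graded `k`-algebra `A = ⨁ i, 𝒜 i`. -/
structure IsGradedModule {A M : Type*} [CommRing A] [Algebra k A] [AddCommGroup M] [Module k M]
    [Module A M] (𝒜 : ℤ → Submodule k A) (ℳ : ℤ → Submodule k M) : Prop where
  isInternal : DirectSum.IsInternal ℳ
  smul_mem : ∀ {i j : ℤ} {a : A} {m : M}, a ∈ 𝒜 i → m ∈ ℳ j → a • m ∈ ℳ (i + j)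

/-- The Hilbert series `∑ i, dim_k (ℳ i) t ^ i` is a Laurent series with finite coefficients, and
it is the expansion at `t = 0` of the rational function `φ`. -/
def IsHilbertSeries {M : Type*} [AddCommGroup M] [Module k M] (ℳ : ℤ → Submodule k M)
    (φ : RatFunc ℚ) : Prop :=
  (∀ i, Module.Finite k (ℳ i)) ∧
    ∀ i : ℤ, (φ : LaurentSeries ℚ).coeff i = (Module.finrank k (ℳ i) : ℚ)

/-- The Hilbert series of the graded vector space is a rational function. -/
def HasRationalHilbertSeries {M : Type*} [AddCommGroup M] [Module k M]
    (ℳ : ℤ → Submodule k M) : Prop :=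
  ∃ φ : RatFunc ℚ, IsHilbertSeries ℳ φ

open Classical in
/-- The Hilbert series `H(M, t)` as a rational function of `t` (with the value `0` if the Hilbert
series is not a rational function). -/
def hilbertSeries {M : Type*} [AddCommGroup M] [Module k M] (ℳ : ℤ → Submodule k M) :
    RatFunc ℚ :=
  if h : HasRationalHilbertSeries ℳ then h.choose else 0

/-- The substitution `φ(t) ↦ φ(t⁻¹)` on rational functions. -/
def invVar (φ : RatFunc ℚ) : RatFunc ℚ :=
  RatFunc.eval (RatFunc.C : ℚ →+* RatFunc ℚ) (RatFunc.X : RatFunc ℚ)⁻¹ φ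

end Hilbert

/-! ### Graded free resolutions and graded Ext modules -/

section Resolution

variable {k : Type*} [Field k] {A : Type*} [CommRing A] [Algebra k A] (𝒜 : ℤ → Submodule k A)

/-- The grading of the free module `⨁ p, A(-a p)`, whose `p`-th basis vector has degree `a p`. -/
def freeGrading {r : ℕ} (a : Fin r → ℤ) (i : ℤ) : Submodule k (Fin r → A) :=
  Submodule.pi Set.univ fun p => 𝒜 (i - a p)

/-- A resolution of the graded `A`-module `(M, ℳ)` by finitely generated graded free `A`-modules
`F i = ⨁ p, A(-deg i p)` and homogeneous maps of degree `0`. The differential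
`∂_{i+1} : F (i + 1) → F i` is multiplication by the matrix `d i`, and `aug : F 0 → M` is the
augmentation. -/
structure FreeResolution {M : Type*} [AddCommGroup M] [Module k M] [Module A M]
    (ℳ : ℤ → Submodule k M) where
  rank : ℕ → ℕ
  deg : ∀ i, Fin (rank i) → ℤ
  d : ∀ i, Matrix (Fin (rank i)) (Fin (rank (i + 1))) A
  aug : (Fin (rank 0) → A) →ₗ[A] M
  d_mem : ∀ i p q, d i p q ∈ 𝒜 (deg (i + 1) q - deg i p)
  aug_mem : ∀ p, aug (Pi.single p 1) ∈ ℳ (deg 0 p)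
  aug_surjective : Function.Surjective aug
  exact_aug : Function.Exact (d 0).mulVecLin aug
  exact : ∀ i, Function.Exact (d (i + 1)).mulVecLin (d i).mulVecLin

namespace FreeResolution

variable {𝒜}
variable {M : Type*} [AddCommGroup M] [Module k M] [Module A M] {ℳ : ℤ → Submodule k M}
variable (F : FreeResolution 𝒜 ℳ)

/-- The free module in homological degree `i`. -/
abbrev Obj (i : ℕ) : Type _ := Fin (F.rank i) → A

/-- The differential `∂_{i+1} : F_{i+1} → F_i`. -/
def diff (i : ℕ) : F.Obj (i + 1) →ₗ[A] F.Obj i := (F.d i).mulVecLin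

/-- The resolution is minimal: `∂ F ⊆ 𝔪 F`. -/
def IsMinimal (𝔪 : Ideal A) : Prop := ∀ i p q, F.d i p q ∈ 𝔪

/-- The `i`-th syzygy `Coker ∂_{i+1}`. -/
abbrev Syz (i : ℕ) : Type _ := F.Obj i ⧸ LinearMap.range (F.diff i)

/-- The grading of the `i`-th syzygy, induced by that of `F_i`. -/
def syzGrading (i : ℕ) (j : ℤ) : Submodule k (F.Syz i) :=
  (freeGrading 𝒜 (F.deg i) j).map
    ((LinearMap.range (F.diff i)).mkQ.restrictScalars k)

section Ext

variable {N : Type*} [AddCommGroup N] [Module k N] [Module A N] [IsScalarTower k A N]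
variable (𝒩 : ℤ → Submodule k N)

variable (N) in
/-- The `i`-cocycles of the complex `Hom_A(F, N)`. -/
def cocycles (i : ℕ) : Submodule A (F.Obj i →ₗ[A] N) :=
  LinearMap.ker (LinearMap.lcomp A N (F.diff i))

variable (N) in
/-- The `i`-coboundaries of the complex `Hom_A(F, N)`. -/
def coboundaries : (i : ℕ) → Submodule A (F.Obj i →ₗ[A] N)
  | 0 => ⊥
  | i + 1 => LinearMap.range (LinearMap.lcomp A N (F.diff i))

variable (N) in
/-- `Ext^i_A(M, N)`, the `i`-th cohomology module of `Hom_A(F, N)`. -/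
abbrev Ext (i : ℕ) : Type _ := F.cocycles N i ⧸ (F.coboundaries N i).submoduleOf (F.cocycles N i)

/-- The homomorphisms `F_i → N` that are homogeneous of degree `j`. -/
def homGrading (i : ℕ) (j : ℤ) : Submodule k (F.Obj i →ₗ[A] N) where
  carrier := {φ | ∀ l : ℤ, ∀ v ∈ freeGrading 𝒜 (F.deg i) l, φ v ∈ 𝒩 (l + j)}
  add_mem' h h' l v hv := (𝒩 (l + j)).add_mem (h l v hv) (h' l v hv)
  zero_mem' l _ _ := (𝒩 (l + j)).zero_mem
  smul_mem' c _ h l v hv := (𝒩 (l + j)).smul_mem c (h l v hv)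

/-- The degree `j` part `Ext^i_A(M, N)_j`: the classes of the cocycles of degree `j`. -/
def extGrading (i : ℕ) (j : ℤ) : Submodule k (F.Ext N i) :=
  ((F.homGrading 𝒩 i j).comap ((F.cocycles N i).subtype.restrictScalars k)).map
    (((F.coboundaries N i).submoduleOf (F.cocycles N i)).mkQ.restrictScalars k)

variable (N) in
/-- The length of `Ext^i_A(M, N)`. -/
def extLength (i : ℕ) : ℕ∞ := Module.length A (F.Ext N i)

variable (N) in
/-- The infimum of the integers `n` such that `Ext^i_A(M, N)` has finite length for all `i > n`. -/
def fext : EReal :=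
  sInf {x : EReal | ∃ n : ℤ, x = ((n : ℝ) : EReal) ∧
    ∀ i : ℕ, n < (i : ℤ) → F.extLength N i ≠ ⊤}

variable (N) in
/-- The complexity of the pair `(M, N)`, for a pair such that `Ext^i_A(M, N)` has finite length for
all large `i`: the infimum of the natural numbers `b` such that `λ(Ext^n_A(M, N)) ≤ a n ^ (b - 1)`
for some real number `a` and all large `n`. -/
def complexity : ℕ∞ :=
  sInf {x : ℕ∞ | ∃ b : ℕ, x = (b : ℕ∞) ∧ ∃ a : ℝ, ∀ᶠ n : ℕ in Filter.atTop,
    ((F.extLength N n).toNat : ℝ) ≤ a * (n : ℝ) ^ ((b : ℤ) - 1)}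

/-- `φ_A(M, N)(t) = H(M, t⁻¹) H(N, t) / H(A, t⁻¹)`. -/
def phi (_F : FreeResolution 𝒜 ℳ) : RatFunc ℚ :=
  invVar (hilbertSeries ℳ) * hilbertSeries 𝒩 / invVar (hilbertSeries 𝒜)

/-- `ρ^j_A(M, N)(t) = ∑_{i = 0}^{j} (-1)^i H(Ext^i_A(M, N), t) - φ_A(M, N)(t)`. -/
def rho (j : ℕ) : RatFunc ℚ :=
  ∑ i ∈ Finset.range (j + 1), (-1) ^ i * hilbertSeries (F.extGrading 𝒩 i) - F.phi 𝒩

variable (N) in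
/-- Let `τ_j : F_{j+2} → F_j` be a chain map of degree `-2`. It induces the maps
`χ : Ext^j_A(M, N) → Ext^{j+2}_A(M, N)` that send the class of a cocycle `φ` to the class of
`φ ∘ τ_j`. The condition says that these maps are injective for all `j ≥ s`, that is, that `χ` is a
non-zerodivisor on `Ext^{≥ s}_A(M, N)`. -/
def IsNonzerodivisorFrom (τ : ∀ j, F.Obj (j + 2) →ₗ[A] F.Obj j) (s : ℕ) : Prop :=
  ∀ j, s ≤ j → ∀ φ ∈ F.cocycles N j,
    φ ∘ₗ τ j ∈ F.coboundaries N (j + 2) → φ ∈ F.coboundaries N j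

end Ext

/-- The submodule `{(∂ x, -[τ x])}` of `F_{n+1} ⊕ Syz_n`, for `x ∈ F_{n+2}`. -/
def pushoutRelations (n : ℕ) (τ : F.Obj (n + 2) →ₗ[A] F.Obj n) :
    Submodule A (F.Obj (n + 1) × F.Syz n) :=
  LinearMap.range ((F.diff (n + 1)).prod (-((LinearMap.range (F.diff n)).mkQ ∘ₗ τ)))

/-- The pushout `K` of the inclusion `Syz_{n+2} → F_{n+1}` induced by `∂_{n+2}` and the map
`Syz_{n+2} → Syz_n` induced by a chain map `τ`, that is, the quotient of `F_{n+1} ⊕ Syz_n` by the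
pairs of the image of `x` under the first map and minus its image under the second. The
relations may be indexed by `x ∈ F_{n+2}`, as `F_{n+2} → Syz_{n+2}` is onto. -/
abbrev Pushout (n : ℕ) (τ : F.Obj (n + 2) →ₗ[A] F.Obj n) : Type _ :=
  (F.Obj (n + 1) × F.Syz n) ⧸ F.pushoutRelations n τ

/-- The grading of the pushout as a quotient of `F_{n+1} ⊕ Syz_n(-e)`, where `L(-e)_i = L_{i-e}`,
for a map `τ` that is homogeneous of degree `-e`. -/
def pushoutGrading (n : ℕ) (τ : F.Obj (n + 2) →ₗ[A] F.Obj n) (e : ℤ) (i : ℤ) :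
    Submodule k (F.Pushout n τ) :=
  ((freeGrading 𝒜 (F.deg (n + 1)) i).prod (F.syzGrading n (i - e))).map
    ((F.pushoutRelations n τ).mkQ.restrictScalars k)

end FreeResolution

end Resolution

/-! ### Graded complete intersections and Eisenbud operators -/

section CompleteIntersection

variable {k : Type*} [Field k] {ν c : ℕ}

/-- The ring `k[x_1, …, x_ν] / (f_1, …, f_c)`. -/
abbrev QuotRing (f : Fin c → MvPolynomial (Fin ν) k) : Type _ :=
  MvPolynomial (Fin ν) k ⧸ Ideal.span (Set.range f)

/-- The grading of `k[x_1, …, x_ν] / (f_1, …, f_c)` for which `x_i` has degree `w i`. -/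
def quotGrading (w : Fin ν → ℤ) (f : Fin c → MvPolynomial (Fin ν) k) (i : ℤ) :
    Submodule k (QuotRing f) :=
  (MvPolynomial.weightedHomogeneousSubmodule k w i).map
    (Ideal.Quotient.mkₐ k (Ideal.span (Set.range f))).toLinearMap

/-- The ideal generated by the classes of the variables. -/
def irrelevantIdeal (f : Fin c → MvPolynomial (Fin ν) k) : Ideal (QuotRing f) :=
  (Ideal.span (Set.range MvPolynomial.X)).map (Ideal.Quotient.mk (Ideal.span (Set.range f)))

/-- The variables `x_i` have positive degrees `w i`, and `f_1, …, f_c` is a regular sequence in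
`(x_1, …, x_ν)²` of homogeneous polynomials of degrees `e_1, …, e_c`. -/
structure IsCompleteIntersection (w : Fin ν → ℤ) (f : Fin c → MvPolynomial (Fin ν) k)
    (e : Fin c → ℤ) : Prop where
  weight_pos : ∀ i, 0 < w i
  homogeneous : ∀ m, MvPolynomial.IsWeightedHomogeneous w (f m) (e m)
  mem_sq : ∀ m, f m ∈ (Ideal.span (Set.range MvPolynomial.X) : Ideal (MvPolynomial (Fin ν) k)) ^ 2
  regular : RingTheory.Sequence.IsRegular (MvPolynomial (Fin ν) k) (List.ofFn f)

/-- A choice made in the construction of the Eisenbud operators on `F`: a graded lifting of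
`(F, ∂)` to `Q = k[x_1, …, x_ν]`, with differentials `dLift`, and homogeneous maps
`tauLift m j : F̃_{j+2} → F̃_j(-e_m)` with `∂̃ ∂̃ = ∑ m, f_m • tauLift m`. -/
structure EisenbudData (w : Fin ν → ℤ) (f : Fin c → MvPolynomial (Fin ν) k) (e : Fin c → ℤ)
    {M : Type*} [AddCommGroup M] [Module k M] [Module (QuotRing f) M] {ℳ : ℤ → Submodule k M}
    (F : FreeResolution (quotGrading w f) ℳ) where
  dLift : ∀ j, Matrix (Fin (F.rank j)) (Fin (F.rank (j + 1))) (MvPolynomial (Fin ν) k)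
  tauLift : Fin c → ∀ j, Matrix (Fin (F.rank j)) (Fin (F.rank (j + 2))) (MvPolynomial (Fin ν) k)
  dLift_map : ∀ j, (dLift j).map (Ideal.Quotient.mk (Ideal.span (Set.range f))) = F.d j
  dLift_homogeneous : ∀ j p q,
    MvPolynomial.IsWeightedHomogeneous w (dLift j p q) (F.deg (j + 1) q - F.deg j p)
  tauLift_homogeneous : ∀ m j p q,
    MvPolynomial.IsWeightedHomogeneous w (tauLift m j p q) (F.deg (j + 2) q - e m - F.deg j p)
  dLift_mul_dLift : ∀ j, dLift j * dLift (j + 1) = ∑ m, f m • tauLift m j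

namespace EisenbudData

variable {w : Fin ν → ℤ} {f : Fin c → MvPolynomial (Fin ν) k} {e : Fin c → ℤ}
  {M : Type*} [AddCommGroup M] [Module k M] [Module (QuotRing f) M] {ℳ : ℤ → Submodule k M}
  {F : FreeResolution (quotGrading w f) ℳ}

/-- The Eisenbud operator `τ^m_j = τ̃^m_j ⊗ R : F_{j+2} → F_j(-e_m)`. -/
def op (E : EisenbudData w f e F) (m : Fin c) (j : ℕ) : F.Obj (j + 2) →ₗ[QuotRing f] F.Obj j :=
  ((E.tauLift m j).map (Ideal.Quotient.mk (Ideal.span (Set.range f)))).mulVecLin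

/-- The chain map `τ = ∑ m, a_m τ^m`, which induces the multiplication by `χ = ∑ m, a_m χ_m` on
the Ext modules. -/
def comb (E : EisenbudData w f e F) (a : Fin c → QuotRing f) (j : ℕ) :
    F.Obj (j + 2) →ₗ[QuotRing f] F.Obj j :=
  ∑ m, a m • E.op m j

end EisenbudData

end CompleteIntersection

end GradedExt

end

/-! Write P_i(t) for the sum of t^a over the degrees a of a basis of F_i. Then H(F_i, t) = P_i(t)
H(R, t), whereas H(Hom(F_i, N), t) = P_i(t⁻¹) H(N, t). Let β_i be the Hilbert series of the image of
F_{i+1} in F_i, and γ_i that of the i-coboundaries of Hom(F, N). Exactness gives H(F_0) = H(M) + β_0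
and H(F_{i+1}) = β_i + β_{i+1}; cohomology gives H(Hom(F_i, N)) = H(Ext^i) + γ_i + γ_{i+1}. The
alternating sum telescopes (`rho_eq`), leaving ρ^n(M, N) = (-1)^n (β_n(t⁻¹) H(N, t) / H(R, t⁻¹) -
γ_{n+1}).

For the pushout, the cone of the chain map τ gives the start of a free resolution, F_{n+3} ⊕
F_{n+2}(-e) → F_{n+2} ⊕ F_{n+1}(-e) → F_{n+1} ⊕ F_n(-e) → K → 0, and the exact sequence 0 →
Syz_n(-e) → K → Syz_{n+1} → 0 gives H(K) (`hilbertFun_pushoutGrading`). A 0-cocycle of the cone is a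
pair (θ, φ) with φ a cocycle and φτ = θ∂. Thus χ kills the class of φ, so φ is a coboundary by
injectivity, and every coboundary φ occurs (`hilbertFun_ker_coneDiff`). The same argument one step
up uses injectivity on Ext^{n+1}. Counting dimensions, H(Ext^0(K, N)) = H(Ext^{n+1}) + γ_{n+1} +
t^{-e} γ_n and H(Ext^1(K, N)) = H(Ext^{n+2}) - t^{-e} H(Ext^n) (`hilbertFun_extGrading_pushout`).
The formula follows by algebra (`rho_identity`).

Three facts support this. Rationality is the Hilbert–Serre theorem, applied also to the cocycles
inside Hom(F_i, N). The cone may replace an arbitrary resolution of K because graded projective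
presentations have the same Ext^0 and Ext^1 (`IsGradedPresentation.finrank_le`). Finally, τ commutes
with ∂ on the nose because relations among a regular sequence have coefficients in the ideal it
generates (`diff_comp_op`). -/

noncomputable section

set_option linter.unusedSectionVars false

namespace GradedExt

universe u v

/-! ### Components of elements of graded vector spaces -/

section Components

variable {k : Type*} [Field k] {V W : Type*} [AddCommGroup V] [Module k V] [AddCommGroup W]
  [Module k W] {𝒱 : ℤ → Submodule k V} {𝒲 : ℤ → Submodule k W}

/-- The projection of a graded vector space onto its component of degree `j`. -/
def comp (h : DirectSum.IsInternal 𝒱) (j : ℤ) : V →ₗ[k] V :=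
  (𝒱 j).subtype ∘ₗ DirectSum.component k ℤ (fun i => 𝒱 i) j ∘ₗ
    (LinearEquiv.ofBijective (DirectSum.coeLinearMap 𝒱) h).symm.toLinearMap

theorem comp_mem (h : DirectSum.IsInternal 𝒱) (j : ℤ) (v : V) : comp h j v ∈ 𝒱 j :=
  Subtype.property _

theorem comp_of_mem (h : DirectSum.IsInternal 𝒱) {i : ℤ} {v : V} (hv : v ∈ 𝒱 i) (j : ℤ) :
    comp h j v = if i = j then v else 0 := by
  have : (LinearEquiv.ofBijective (DirectSum.coeLinearMap 𝒱) h).symm v =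
      DirectSum.lof k ℤ (fun i => 𝒱 i) i ⟨v, hv⟩ := by
    rw [LinearEquiv.symm_apply_eq]
    exact (DirectSum.coeLinearMap_lof 𝒱 i (⟨v, hv⟩ : 𝒱 i)).symm
  simp only [comp, LinearMap.comp_apply, LinearEquiv.coe_coe, this, DirectSum.component.of]
  split_ifs with hij
  · subst hij; rfl
  · simp

theorem comp_same (h : DirectSum.IsInternal 𝒱) {i : ℤ} {v : V} (hv : v ∈ 𝒱 i) :
    comp h i v = v := by simp [comp_of_mem h hv]

theorem comp_ne (h : DirectSum.IsInternal 𝒱) {i j : ℤ} {v : V} (hv : v ∈ 𝒱 i) (hij : i ≠ j) :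
    comp h j v = 0 := by simp [comp_of_mem h hv, hij]

theorem iSup_eq_top (h : DirectSum.IsInternal 𝒱) : iSup 𝒱 = ⊤ := h.submodule_iSup_eq_top

theorem exists_eq_sum_comp (h : DirectSum.IsInternal 𝒱) (v : V) :
    ∃ s : Finset ℤ, (∀ j ∉ s, comp h j v = 0) ∧ v = ∑ j ∈ s, comp h j v := by
  classical
  set x := (LinearEquiv.ofBijective (DirectSum.coeLinearMap 𝒱) h).symm v with hx
  have hc : ∀ j, comp h j v = x j := fun j => rfl
  refine ⟨DFinsupp.support x, fun j hj => ?_, ?_⟩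
  · rw [hc]; simpa using hj
  · have : v = DirectSum.coeLinearMap 𝒱 x :=
      ((LinearEquiv.ofBijective (DirectSum.coeLinearMap 𝒱) h).apply_symm_apply v).symm
    conv_lhs => rw [this]
    rw [DirectSum.coeLinearMap_eq_dfinsuppSum]
    rfl

/-- Independence holds because `π i` fixes the i-th piece and kills the sum of the others. The
gradings on quotients, powers and products below are all checked this way. -/
theorem isInternal_of_projections (π : ℤ → V →ₗ[k] V) (h1 : ∀ i, ∀ v ∈ 𝒱 i, π i v = v)
    (h2 : ∀ i j, i ≠ j → ∀ v ∈ 𝒱 i, π j v = 0) (h3 : iSup 𝒱 = ⊤) : DirectSum.IsInternal 𝒱 := by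
  classical
  rw [DirectSum.isInternal_submodule_iff_iSupIndep_and_iSup_eq_top]
  refine ⟨?_, h3⟩
  intro i
  rw [Submodule.disjoint_def]
  intro v hv hv'
  have : (⨆ j, ⨆ (_ : j ≠ i), 𝒱 j) ≤ LinearMap.ker (π i) :=
    iSup_le fun j => iSup_le fun hj v hv => h2 j i hj v hv
  rw [← h1 i v hv]
  exact this hv'

/-- Projections commute with homogeneous maps. -/
theorem comp_map (hV : DirectSum.IsInternal 𝒱) (hW : DirectSum.IsInternal 𝒲) (g : V →ₗ[k] W)
    (d : ℤ) (hg : ∀ i, ∀ v ∈ 𝒱 i, g v ∈ 𝒲 (i + d)) (j : ℤ) (v : V) :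
    comp hW (j + d) (g v) = g (comp hV j v) := by
  have : (⊤ : Submodule k V) ≤ LinearMap.eqLocus (comp hW (j + d) ∘ₗ g) (g ∘ₗ comp hV j) := by
    rw [← iSup_eq_top hV]
    refine iSup_le fun i v hv => ?_
    simp only [LinearMap.mem_eqLocus, LinearMap.comp_apply]
    rw [comp_of_mem hW (hg i v hv), comp_of_mem hV hv]
    by_cases hij : i = j
    · simp [hij]
    · simp [hij]
  exact this (Submodule.mem_top (x := v))

theorem comp_map_zero (hV : DirectSum.IsInternal 𝒱) (hW : DirectSum.IsInternal 𝒲) (g : V →ₗ[k] W)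
    (hg : ∀ i, ∀ v ∈ 𝒱 i, g v ∈ 𝒲 i) (j : ℤ) (v : V) :
    comp hW j (g v) = g (comp hV j v) := by
  simpa using comp_map hV hW g 0 (by simpa using hg) j v

/-- The image of a grading under a surjection with homogeneous kernel is a grading. -/
theorem isInternal_map (hV : DirectSum.IsInternal 𝒱) (g : V →ₗ[k] W) (hg : Function.Surjective g)
    (hker : ∀ v, g v = 0 → ∀ j, g (comp hV j v) = 0) :
    DirectSum.IsInternal fun j => (𝒱 j).map g := by
  obtain ⟨σ, hσ⟩ := g.exists_rightInverse_of_surjective (LinearMap.range_eq_top.2 hg)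
  -- The section `σ` respects no grading, but `σ (g v)` and `v` differ by an element of the kernel,
  -- whose components stay in the kernel.
  have key : ∀ j v, g (comp hV j (σ (g v))) = g (comp hV j v) := by
    intro j v
    rw [← sub_eq_zero, ← map_sub, ← map_sub]
    apply hker
    rw [map_sub, sub_eq_zero]
    exact LinearMap.congr_fun hσ (g v)
  refine isInternal_of_projections (fun j => g ∘ₗ comp hV j ∘ₗ σ) ?_ ?_ ?_
  · rintro i _ ⟨v, hv, rfl⟩
    simp [key, comp_same hV hv]
  · rintro i j hij _ ⟨v, hv, rfl⟩
    simp [key, comp_ne hV hv hij]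
  · rw [← Submodule.map_iSup, iSup_eq_top hV, Submodule.map_top, LinearMap.range_eq_top.2 hg]

/-- A homogeneous element of the image of a graded map is the image of a homogeneous element. -/
theorem map_eq_inf_range (hV : DirectSum.IsInternal 𝒱) (hW : DirectSum.IsInternal 𝒲)
    (g : V →ₗ[k] W) (hg : ∀ i, ∀ v ∈ 𝒱 i, g v ∈ 𝒲 i) (j : ℤ) :
    (𝒱 j).map g = 𝒲 j ⊓ LinearMap.range g := by
  refine le_antisymm ?_ ?_
  · rintro _ ⟨v, hv, rfl⟩
    exact ⟨hg j v hv, v, rfl⟩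
  · rintro _ ⟨h, v, rfl⟩
    exact ⟨comp hV j v, comp_mem hV j v, by rw [← comp_map_zero hV hW g hg, comp_same hW h]⟩

/-- The grading of `V ^ r` with shifts. -/
def shiftPi (𝒱 : ℤ → Submodule k V) {r : ℕ} (a : Fin r → ℤ) (j : ℤ) : Submodule k (Fin r → V) :=
  Submodule.pi Set.univ fun p => 𝒱 (j - a p)

theorem mem_shiftPi {r : ℕ} {a : Fin r → ℤ} {j : ℤ} {v : Fin r → V} :
    v ∈ shiftPi 𝒱 a j ↔ ∀ p, v p ∈ 𝒱 (j - a p) := by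
  simp [shiftPi, Submodule.mem_pi]

theorem isInternal_shiftPi (hV : DirectSum.IsInternal 𝒱) {r : ℕ} (a : Fin r → ℤ) :
    DirectSum.IsInternal (shiftPi 𝒱 a) := by
  classical
  refine isInternal_of_projections
    (fun j => LinearMap.pi fun p => comp hV (j - a p) ∘ₗ LinearMap.proj p) ?_ ?_ ?_
  · intro i v hv
    ext p
    simpa using comp_same hV (mem_shiftPi.1 hv p)
  · intro i j hij v hv
    ext p
    simpa using comp_ne hV (mem_shiftPi.1 hv p) (fun h => hij (by linarith))
  · rw [eq_top_iff]
    intro v _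
    rw [← Finset.univ_sum_single v]
    refine Submodule.sum_mem _ fun p _ => ?_
    have : (⊤ : Submodule k V) ≤ (iSup (shiftPi 𝒱 a)).comap (LinearMap.single k (fun _ => V) p) := by
      rw [← iSup_eq_top hV]
      refine iSup_le fun i x hx => ?_
      refine Submodule.mem_iSup_of_mem (i + a p) (mem_shiftPi.2 fun q => ?_)
      by_cases hq : q = p
      · subst hq; simpa using hx
      · simp [Pi.single_eq_of_ne hq]
    exact this (Submodule.mem_top (x := v p))

theorem isInternal_prod_shift (hV : DirectSum.IsInternal 𝒱) (hW : DirectSum.IsInternal 𝒲) (e : ℤ) :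
    DirectSum.IsInternal fun j => (𝒱 j).prod (𝒲 (j - e)) := by
  refine isInternal_of_projections (fun j => (comp hV j).prodMap (comp hW (j - e))) ?_ ?_ ?_
  · rintro i ⟨v, w⟩ ⟨hv, hw⟩
    simp [comp_same hV hv, comp_same hW hw]
  · rintro i j hij ⟨v, w⟩ ⟨hv, hw⟩
    have hij' : i - e ≠ j - e := fun h => hij (by linarith)
    simp [comp_ne hV hv hij, comp_ne hW hw hij']
  · rw [eq_top_iff]
    rintro ⟨v, w⟩ -
    have h1 : (⊤ : Submodule k V) ≤
        (⨆ j, (𝒱 j).prod (𝒲 (j - e))).comap (LinearMap.inl k V W) := by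
      rw [← iSup_eq_top hV]
      exact iSup_le fun i x hx => Submodule.mem_iSup_of_mem i ⟨hx, zero_mem _⟩
    have h2 : (⊤ : Submodule k W) ≤
        (⨆ j, (𝒱 j).prod (𝒲 (j - e))).comap (LinearMap.inr k V W) := by
      rw [← iSup_eq_top hW]
      exact iSup_le fun i x hx =>
        Submodule.mem_iSup_of_mem (i + e) ⟨zero_mem _, by simpa using hx⟩
    have h1' := h1 (Submodule.mem_top (x := v))
    have h2' := h2 (Submodule.mem_top (x := w))
    simpa using add_mem (Submodule.mem_comap.1 h1') (Submodule.mem_comap.1 h2')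

/-! ### Dimensions -/

theorem finrank_map_add_inf_ker (g : V →ₗ[k] W) (U : Submodule k V) [Module.Finite k U] :
    Module.finrank k (U.map g) + Module.finrank k (U ⊓ LinearMap.ker g : Submodule k V) =
      Module.finrank k U := by
  have h := (g.domRestrict U).finrank_range_add_finrank_ker
  rw [LinearMap.range_domRestrict, LinearMap.ker_domRestrict] at h
  rw [← h, ← Submodule.finrank_map_subtype_eq, Submodule.map_comap_subtype]

theorem finrank_map_of_injOn (g : V →ₗ[k] W) (U : Submodule k V) [Module.Finite k U]
    (h : ∀ v ∈ U, g v = 0 → v = 0) : Module.finrank k (U.map g) = Module.finrank k U := by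
  rw [← finrank_map_add_inf_ker g U]
  have : U ⊓ LinearMap.ker g = ⊥ := by
    rw [eq_bot_iff]
    rintro v ⟨hv, hv'⟩
    exact h v hv hv'
  rw [this, finrank_bot, add_zero]

theorem finite_of_le {U U' : Submodule k V} (h : U ≤ U') [Module.Finite k U'] :
    Module.Finite k U :=
  Module.Finite.of_injective (Submodule.inclusion h) (Submodule.inclusion_injective h)

theorem finite_comap (g : V →ₗ[k] W) (hg : Function.Injective g) (U : Submodule k W)
    [Module.Finite k U] : Module.Finite k (U.comap g) :=
  Module.Finite.of_injective (g.restrict (p := U.comap g) (q := U) fun _ h => h)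
    fun _ _ hab => Subtype.ext (hg (congrArg Subtype.val hab))

/-- The submodule `U ^ r` of `V ^ r`, with varying factors, is a product. -/
def piEquiv {r : ℕ} (U : Fin r → Submodule k V) :
    (Submodule.pi Set.univ U : Submodule k (Fin r → V)) ≃ₗ[k] ((p : Fin r) → U p) where
  toFun v p := ⟨v.1 p, v.2 p trivial⟩
  invFun v := ⟨fun p => v p, fun p _ => (v p).2⟩
  map_add' _ _ := rfl
  map_smul' _ _ := rfl
  left_inv _ := rfl
  right_inv _ := rfl

theorem finite_shiftPi (h : ∀ i, Module.Finite k (𝒱 i)) {r : ℕ} (a : Fin r → ℤ) (j : ℤ) :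
    Module.Finite k (shiftPi 𝒱 a j) :=
  Module.Finite.equiv (piEquiv fun p => 𝒱 (j - a p)).symm

theorem finrank_shiftPi (h : ∀ i, Module.Finite k (𝒱 i)) {r : ℕ} (a : Fin r → ℤ) (j : ℤ) :
    Module.finrank k (shiftPi 𝒱 a j) = ∑ p, Module.finrank k (𝒱 (j - a p)) := by
  rw [← Module.finrank_pi_fintype k]
  exact (piEquiv fun p => 𝒱 (j - a p)).finrank_eq

/-- The product of two submodules is the product of the corresponding modules. -/
def prodSubEquiv (U : Submodule k V) (U' : Submodule k W) : (U.prod U') ≃ₗ[k] (U × U') where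
  toFun v := (⟨v.1.1, v.2.1⟩, ⟨v.1.2, v.2.2⟩)
  invFun v := ⟨(v.1, v.2), v.1.2, v.2.2⟩
  map_add' _ _ := rfl
  map_smul' _ _ := rfl
  left_inv _ := rfl
  right_inv _ := rfl

theorem finite_prod (U : Submodule k V) (U' : Submodule k W) [Module.Finite k U]
    [Module.Finite k U'] : Module.Finite k (U.prod U') :=
  Module.Finite.equiv (prodSubEquiv U U').symm

theorem finrank_prod (U : Submodule k V) (U' : Submodule k W) [Module.Finite k U]
    [Module.Finite k U'] :
    Module.finrank k (U.prod U') = Module.finrank k U + Module.finrank k U' := by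
  rw [(prodSubEquiv U U').finrank_eq, Module.finrank_prod]

end Components

/-! ### Rational generating functions -/

section RationalFunctions

variable {F : Type*} [Field F]

/-- The Laurent series `∑ i, u i * t ^ i` is the expansion at `t = 0` of `φ`. -/
def IsGenFun (φ : RatFunc F) (u : ℤ → F) : Prop :=
  ∀ i : ℤ, (φ : LaurentSeries F).coeff i = u i

/-- Expansion at 0 embeds the field of rational functions into Laurent series, so identities between
Hilbert series may be checked one degree at a time. -/
theorem IsGenFun.unique {φ ψ : RatFunc F} {u : ℤ → F} (h : IsGenFun φ u) (h' : IsGenFun ψ u) :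
    φ = ψ := by
  have hinj : Function.Injective fun φ : RatFunc F => (φ : LaurentSeries F) :=
    RingHom.injective _
  exact hinj (HahnSeries.ext (funext fun i => (h i).trans (h' i).symm))

theorem IsGenFun.congr {φ : RatFunc F} {u v : ℤ → F} (h : IsGenFun φ u) (huv : ∀ i, u i = v i) :
    IsGenFun φ v := fun i => (h i).trans (huv i)

theorem IsGenFun.zero : IsGenFun (F := F) 0 fun _ => 0 := fun i => by simp

theorem IsGenFun.add {φ ψ : RatFunc F} {u v : ℤ → F} (h : IsGenFun φ u) (h' : IsGenFun ψ v) :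
    IsGenFun (φ + ψ) fun i => u i + v i := fun i => by
  simp [← h i, ← h' i]

theorem IsGenFun.sub {φ ψ : RatFunc F} {u v : ℤ → F} (h : IsGenFun φ u) (h' : IsGenFun ψ v) :
    IsGenFun (φ - ψ) fun i => u i - v i := fun i => by
  simp [← h i, ← h' i]

theorem IsGenFun.sum {ι : Type*} (s : Finset ι) {φ : ι → RatFunc F} {u : ι → ℤ → F}
    (h : ∀ p ∈ s, IsGenFun (φ p) (u p)) : IsGenFun (∑ p ∈ s, φ p) fun i => ∑ p ∈ s, u p i := by
  classical
  induction s using Finset.induction_on with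
  | empty => simpa using IsGenFun.zero
  | insert a s ha ih =>
    rw [Finset.sum_insert ha]
    exact ((h a (by simp)).add (ih fun p hp => h p (by simp [hp]))).congr fun i => by
      rw [Finset.sum_insert ha]

theorem coe_zpow_X (m : ℤ) :
    ((RatFunc.X ^ m : RatFunc F) : LaurentSeries F) = HahnSeries.single m 1 := by
  rw [map_zpow₀, RatFunc.coe_X, ← RatFunc.single_zpow]

theorem IsGenFun.shift {φ : RatFunc F} {u : ℤ → F} (h : IsGenFun φ u) (m : ℤ) :
    IsGenFun (RatFunc.X ^ m * φ) fun i => u (i - m) := fun i => by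
  rw [map_mul, coe_zpow_X, HahnSeries.coeff_single_mul, one_mul, h]

theorem exists_isGenFun_of_finite_support {u : ℤ → F} (J : Finset ℤ) (hu : ∀ j ∉ J, u j = 0) :
    ∃ φ, IsGenFun φ u := by
  refine ⟨∑ j ∈ J, RatFunc.X ^ j * RatFunc.C (u j), fun i => ?_⟩
  have hC : ∀ a : F, ((RatFunc.C a : RatFunc F) : LaurentSeries F) = HahnSeries.single 0 a := by
    intro a
    rw [← RatFunc.algebraMap_C]
    refine (RatFunc.coe_coe (Polynomial.C a)).symm.trans ?_
    rw [Polynomial.coe_C, PowerSeries.coe_C]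
    rfl
  rw [map_sum, HahnSeries.coeff_sum]
  simp only [map_mul, coe_zpow_X, HahnSeries.coeff_single_mul, hC, one_mul]
  by_cases hi : i ∈ J
  · rw [Finset.sum_eq_single i]
    · simp
    · intro j _ hj
      rw [HahnSeries.coeff_single_of_ne (by intro h; apply hj; linarith)]
    · exact fun h => absurd hi h
  · rw [hu i hi]
    refine Finset.sum_eq_zero fun j hj => ?_
    rw [HahnSeries.coeff_single_of_ne]
    rintro h
    exact hi (by rwa [show i = j by linarith])

/-- A sequence bounded below with `u j - u (j - m)` given by a rational function. -/
theorem exists_isGenFun_of_sub_shift {u v : ℤ → F} (b : ℤ) (hb : ∀ j < b, u j = 0) {m : ℤ}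
    (hm : 0 < m) {φ : RatFunc F} (hφ : IsGenFun φ v) (h : ∀ j, u j - u (j - m) = v j) :
    ∃ ψ, IsGenFun ψ u := by
  have hsupp : BddBelow (Function.support u) :=
    ⟨b, fun j hj => not_lt.1 fun hlt => hj (hb j hlt)⟩
  set L : LaurentSeries F := HahnSeries.ofSuppBddBelow u hsupp with hL
  have hLc : ∀ j, L.coeff j = u j := fun j => by
    rw [hL, HahnSeries.coeff_ofSuppBddBelow]
  -- As m > 0, the coefficient of degree 0 is 1. The hypothesis says that (1 - t^m) times the series
  -- of `u` is `φ`, so it remains to divide.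
  have hne : (1 - RatFunc.X ^ m : RatFunc F) ≠ 0 := by
    intro h0
    have h1 := congrArg (fun φ : RatFunc F => (φ : LaurentSeries F).coeff 0) h0
    simp only [map_sub, coe_zpow_X, HahnSeries.coeff_sub, map_one, map_zero] at h1
    rw [HahnSeries.coeff_single_of_ne hm.ne] at h1
    simp at h1
  have hmul : ((1 - RatFunc.X ^ m : RatFunc F) : LaurentSeries F) * L = φ := by
    ext j
    rw [hφ j, ← h j, map_sub, map_one, coe_zpow_X, sub_mul, one_mul, HahnSeries.coeff_sub,
      HahnSeries.coeff_single_mul, hLc, hLc, one_mul]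
  refine ⟨(1 - RatFunc.X ^ m)⁻¹ * φ, fun j => ?_⟩
  rw [map_mul, ← hmul, ← mul_assoc, ← map_mul, inv_mul_cancel₀ hne, map_one, one_mul, hLc]

/-- `RatFunc.eval` respects sums and products only where the denominators do not vanish. Since t⁻¹
is transcendental, no nonzero polynomial vanishes there, and the substitution is a ring
homomorphism. -/
theorem eval₂_inv_X_ne_zero {p : Polynomial F} (hp : p ≠ 0) :
    p.eval₂ (RatFunc.C : F →+* RatFunc F) (RatFunc.X : RatFunc F)⁻¹ ≠ 0 := by
  have : Transcendental F (RatFunc.X : RatFunc F)⁻¹ := by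
    intro h
    have := h.inv
    rw [inv_inv] at this
    exact RatFunc.transcendental_X this
  rw [transcendental_iff] at this
  intro h
  apply hp
  apply this
  rw [Polynomial.aeval_def, RatFunc.algebraMap_eq_C]
  exact h

/-- The substitution `φ(t) ↦ φ(t⁻¹)` as a ring homomorphism. -/
def invVarHom : RatFunc ℚ →+* RatFunc ℚ where
  toFun := invVar
  map_one' := RatFunc.eval_one ..
  map_zero' := RatFunc.eval_zero ..
  map_add' x y := RatFunc.eval_add _ _ (eval₂_inv_X_ne_zero x.denom_ne_zero)
    (eval₂_inv_X_ne_zero y.denom_ne_zero)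
  map_mul' x y := RatFunc.eval_mul _ _ (eval₂_inv_X_ne_zero x.denom_ne_zero)
    (eval₂_inv_X_ne_zero y.denom_ne_zero)

theorem invVarHom_apply (φ : RatFunc ℚ) : invVarHom φ = invVar φ := rfl

theorem invVarHom_zpow_X (m : ℤ) : invVarHom (RatFunc.X ^ m) = RatFunc.X ^ (-m) := by
  rw [map_zpow₀, zpow_neg, ← inv_zpow]
  congr 1
  exact RatFunc.eval_X ..

end RationalFunctions

/-! ### Hilbert functions and the chosen rational Hilbert series -/

section HilbertSeries

variable {k : Type*} [Field k] {M : Type*} [AddCommGroup M] [Module k M]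
  {ℳ : ℤ → Submodule k M}

/-- The Hilbert function of a graded vector space. -/
def hilbertFun (ℳ : ℤ → Submodule k M) (i : ℤ) : ℚ := Module.finrank k (ℳ i)

theorem hilbertFun_congr {V : Type*} [AddCommGroup V] [Module k V] {𝒱 𝒲 : ℤ → Submodule k V}
    {i j : ℤ} (h : 𝒱 i = 𝒲 j) : hilbertFun 𝒱 i = hilbertFun 𝒲 j := by
  unfold hilbertFun
  rw [h]

theorem hilbertFun_eq_zero {i : ℤ} (h : ℳ i = ⊥) : hilbertFun ℳ i = 0 := by
  unfold hilbertFun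
  rw [h, finrank_bot, Nat.cast_zero]

theorem IsHilbertSeries.hilbertSeries_eq {φ : RatFunc ℚ} (h : IsHilbertSeries ℳ φ) :
    hilbertSeries ℳ = φ := by
  have h' : HasRationalHilbertSeries ℳ := ⟨φ, h⟩
  rw [hilbertSeries, dif_pos h']
  exact IsGenFun.unique h'.choose_spec.2 h.2

theorem HasRationalHilbertSeries.isGenFun (h : HasRationalHilbertSeries ℳ) :
    IsGenFun (hilbertSeries ℳ) (hilbertFun ℳ) := by
  obtain ⟨φ, hφ⟩ := h
  rw [hφ.hilbertSeries_eq]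
  exact hφ.2

end HilbertSeries

/-! ### The Hilbert–Serre theorem -/

section HilbertSerre

variable {k : Type*} [Field k] {A : Type*} [CommRing A] [Algebra k A]
  {M : Type*} [AddCommGroup M] [Module k M] [Module A M] [IsScalarTower k A M]
  {ι : Type*} {x : ι → A} {w : ι → ℤ} {ℳ : ℤ → Submodule k M}

theorem smul_mem_of_adjoin_eq_top (hx : Algebra.adjoin k (Set.range x) = ⊤) (P : Submodule k M)
    (h : ∀ i, ∀ m ∈ P, x i • m ∈ P) (a : A) {m : M} (hm : m ∈ P) : a • m ∈ P := by
  have ha : a ∈ Algebra.adjoin k (Set.range x) := hx ▸ Algebra.mem_top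
  induction ha using Algebra.adjoin_induction generalizing m with
  | mem y hy =>
    obtain ⟨i, rfl⟩ := hy
    exact h i m hm
  | algebraMap r =>
    rw [algebraMap_smul]
    exact P.smul_mem r hm
  | add y z _ _ hy hz =>
    rw [add_smul]
    exact P.add_mem (hy hm) (hz hm)
  | mul y z _ _ hy hz =>
    rw [mul_smul]
    exact hy (hz hm)

/-- Multiplication by a ring element as a linear map over the base field. -/
def mulMap (k : Type*) [Field k] {A : Type*} [CommRing A] [Algebra k A] (M : Type*)
    [AddCommGroup M] [Module k M] [Module A M] [IsScalarTower k A M] (a : A) : M →ₗ[k] M :=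
  (LinearMap.lsmul A M a).restrictScalars k

@[simp]
theorem mulMap_apply (a : A) (m : M) : mulMap k M a m = a • m := rfl

theorem comp_smul (hM : DirectSum.IsInternal ℳ) {a : A} {d : ℤ}
    (ha : ∀ j, ∀ m ∈ ℳ j, a • m ∈ ℳ (j + d)) (j : ℤ) (m : M) :
    comp hM j (a • m) = a • comp hM (j - d) m := by
  simpa using comp_map hM hM (mulMap k M a) d ha (j - d) m

theorem exists_spanning_components (hM : DirectSum.IsInternal ℳ) [Module.Finite A M] :
    ∃ H : Finset (ℤ × M), (∀ p ∈ H, p.2 ∈ ℳ p.1) ∧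
      Submodule.span A (Prod.snd '' (H : Set (ℤ × M))) = ⊤ := by
  classical
  obtain ⟨T, hT⟩ := Module.Finite.fg_top (R := A) (M := M)
  choose s hs1 hs2 using exists_eq_sum_comp hM
  refine ⟨T.biUnion fun t => (s t).image fun j => (j, comp hM j t), ?_, ?_⟩
  · intro p hp
    simp only [Finset.mem_biUnion, Finset.mem_image] at hp
    obtain ⟨t, -, j, -, rfl⟩ := hp
    exact comp_mem hM j t
  · rw [eq_top_iff, ← hT, Submodule.span_le]
    intro t ht
    rw [hs2 t]
    refine Submodule.sum_mem _ fun j hj => Submodule.subset_span ⟨(j, comp hM j t), ?_, rfl⟩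
    simp only [Finset.coe_biUnion, Set.mem_iUnion, Finset.coe_image]
    exact ⟨t, ht, j, hj, rfl⟩

/-- Monomials in the `x i` applied to homogeneous generators span each component. Positive weights
then leave finitely many monomials in a given degree and none in very negative degrees, which gives
the next two results. -/
theorem le_span_monomials [Fintype ι] (hx : Algebra.adjoin k (Set.range x) = ⊤)
    (hM : DirectSum.IsInternal ℳ)
    (hxM : ∀ i j, ∀ m ∈ ℳ j, x i • m ∈ ℳ (j + w i)) {H : Finset (ℤ × M)}
    (hH : ∀ p ∈ H, p.2 ∈ ℳ p.1) (hspan : Submodule.span A (Prod.snd '' (H : Set (ℤ × M))) = ⊤)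
    (j : ℤ) :
    ℳ j ≤ Submodule.span k {m | ∃ p ∈ H, ∃ d : ι → ℕ, ∑ i, w i * d i + p.1 = j ∧
      m = (∏ i, x i ^ d i) • p.2} := by
  classical
  set S : ℤ → Submodule k M := fun j => Submodule.span k {m | ∃ p ∈ H, ∃ d : ι → ℕ,
    ∑ i, w i * d i + p.1 = j ∧ m = (∏ i, x i ^ d i) • p.2} with hS
  have hxS : ∀ i j, ∀ m ∈ S j, x i • m ∈ S (j + w i) := by
    intro i j m hm
    refine (Submodule.span_le (p := (S (j + w i)).comap (mulMap k M (x i)))).2 ?_ hm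
    rintro _ ⟨p, hp, d, hd, rfl⟩
    refine Submodule.subset_span ⟨p, hp, d + Pi.single i 1, ?_, ?_⟩
    · rw [← hd]
      simp only [Pi.add_apply, Nat.cast_add, mul_add, Finset.sum_add_distrib]
      rw [Finset.sum_eq_single (a := i) (f := fun q => w q * ((Pi.single i 1 : ι → ℕ) q : ℤ))]
      · simp; ring
      · intro q _ hq; simp [hq]
      · simp
    · simp only [Pi.add_apply, pow_add, Finset.prod_mul_distrib, mulMap_apply, smul_smul]
      rw [Finset.prod_eq_single (a := i) (f := fun q => x q ^ ((Pi.single i 1 : ι → ℕ) q))]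
      · simp [mul_comm]
      · intro q _ hq; simp [hq]
      · simp
  -- The elements all of whose components are combinations of monomials of the right degree. This is
  -- stable under the `x i`, hence an A-submodule, and it contains the generators.
  let P : Submodule k M := ⨅ j, (S j).comap (comp hM j)
  have hP : ∀ m, m ∈ P ↔ ∀ j, comp hM j m ∈ S j := fun m => by simp [P, Submodule.mem_iInf]
  have hPx : ∀ i, ∀ m ∈ P, x i • m ∈ P := by
    intro i m hm
    rw [hP] at hm ⊢
    intro j
    rw [comp_smul hM (hxM i)]
    simpa using hxS i _ _ (hm (j - w i))
  let P' : Submodule A M :=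
    { P with smul_mem' := fun a m hm => smul_mem_of_adjoin_eq_top hx P hPx a hm }
  have htop : (⊤ : Submodule A M) ≤ P' := by
    rw [← hspan, Submodule.span_le]
    rintro _ ⟨p, hp, rfl⟩
    refine (hP _).2 fun j => ?_
    rw [comp_of_mem hM (hH p hp)]
    split_ifs with h
    · exact Submodule.subset_span ⟨p, hp, 0, by simpa using h, by simp⟩
    · exact zero_mem _
  intro m hm
  have := (hP m).1 (htop (Submodule.mem_top (x := m))) j
  rwa [comp_same hM hm] at this

theorem finite_component [Fintype ι] (hx : Algebra.adjoin k (Set.range x) = ⊤)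
    (hw : ∀ i, 0 < w i) (hM : DirectSum.IsInternal ℳ)
    (hxM : ∀ i j, ∀ m ∈ ℳ j, x i • m ∈ ℳ (j + w i)) [Module.Finite A M] (j : ℤ) :
    Module.Finite k (ℳ j) := by
  obtain ⟨H, hH, hspan⟩ := exists_spanning_components (A := A) hM
  have hfin : {m : M | ∃ p ∈ H, ∃ d : ι → ℕ, ∑ i, w i * d i + p.1 = j ∧
      m = (∏ i, x i ^ d i) • p.2}.Finite := by
    have : ∀ p : ℤ × M, {d : ι → ℕ | ∑ i, w i * d i + p.1 = j}.Finite := by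
      intro p
      refine (Set.Finite.pi' fun _ : ι => Set.finite_Iic (j - p.1).toNat).subset fun d hd i => ?_
      have h1 : w i * d i ≤ ∑ i, w i * (d i : ℤ) :=
        Finset.single_le_sum (f := fun i => w i * (d i : ℤ))
          (fun q _ => mul_nonneg (hw q).le (Int.natCast_nonneg _)) (Finset.mem_univ i)
      have h2 : (d i : ℤ) ≤ w i * d i :=
        le_mul_of_one_le_left (Int.natCast_nonneg _) (hw i)
      have h3 : ∑ i, w i * (d i : ℤ) + p.1 = j := hd
      have : (d i : ℤ) ≤ j - p.1 := by linarith
      simp only [Set.mem_Iic]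
      omega
    refine (H.finite_toSet.biUnion fun p _ =>
      (this p).image fun d => (∏ i, x i ^ d i) • p.2).subset ?_
    rintro m ⟨p, hp, d, hd, rfl⟩
    exact Set.mem_biUnion hp ⟨d, hd, rfl⟩
  have := Module.Finite.span_of_finite k hfin
  exact finite_of_le (le_span_monomials hx hM hxM hH hspan j)

theorem exists_component_eq_bot [Fintype ι] (hx : Algebra.adjoin k (Set.range x) = ⊤)
    (hw : ∀ i, 0 < w i) (hM : DirectSum.IsInternal ℳ)
    (hxM : ∀ i j, ∀ m ∈ ℳ j, x i • m ∈ ℳ (j + w i)) [Module.Finite A M] :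
    ∃ b : ℤ, ∀ j < b, ℳ j = ⊥ := by
  classical
  obtain ⟨H, hH, hspan⟩ := exists_spanning_components (A := A) hM
  obtain ⟨b, hb⟩ := (H.image Prod.fst).bddBelow
  refine ⟨b, fun j hj => ?_⟩
  rw [eq_bot_iff]
  refine (le_span_monomials hx hM hxM hH hspan j).trans (Submodule.span_le.2 ?_)
  rintro m ⟨p, hp, d, hd, rfl⟩
  have h1 : b ≤ p.1 := hb (by simpa using ⟨p.2, hp⟩)
  have h2 : 0 ≤ ∑ i, w i * (d i : ℤ) :=
    Finset.sum_nonneg fun q _ => mul_nonneg (hw q).le (Int.natCast_nonneg _)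
  linarith

/-- A submodule that contains the components of its elements. -/
def IsHomog (hM : DirectSum.IsInternal ℳ) (U : Submodule A M) : Prop :=
  ∀ v ∈ U, ∀ j, comp hM j v ∈ U

/-- The component of degree `j` of a homogeneous submodule. -/
def part (ℳ : ℤ → Submodule k M) (U : Submodule A M) (j : ℤ) : Submodule k M :=
  ℳ j ⊓ U.restrictScalars k

/-- Multiplication by a maps V onto (aV + U)/U with kernel (U : a) ∩ V; this is rank–nullity for
that map in one degree. Working with submodules of M avoids gradings on quotients. -/
theorem finrank_part_sup_smul (hM : DirectSum.IsInternal ℳ) (hfin : ∀ j, Module.Finite k (ℳ j))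
    {U V : Submodule A M} (hU : IsHomog hM U) (hV : IsHomog hM V) {a : A} {d : ℤ}
    (ha : ∀ j, ∀ m ∈ ℳ j, a • m ∈ ℳ (j + d)) (j : ℤ) :
    (hilbertFun (part ℳ (V.map (LinearMap.lsmul A M a) ⊔ U)) j - hilbertFun (part ℳ U) j) =
      hilbertFun (part ℳ V) (j - d) -
        hilbertFun (part ℳ (U.comap (LinearMap.lsmul A M a) ⊓ V)) (j - d) := by
  have hf : ∀ (W : Submodule A M) j, Module.Finite k (part ℳ W j) := fun W j =>
    finite_of_le (inf_le_left : part ℳ W j ≤ ℳ j)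
  have hf' : ∀ (W : Submodule A M) j, Module.Finite k ((part ℳ W j).map (mulMap k M a)) :=
    fun W j => inferInstance
  have ha' : ∀ m ∈ ℳ (j - d), a • m ∈ ℳ j := fun m hm => by simpa using ha _ m hm
  have h1 : part ℳ (V.map (LinearMap.lsmul A M a) ⊔ U) j =
      (part ℳ V (j - d)).map (mulMap k M a) ⊔ part ℳ U j := by
    apply le_antisymm
    · rintro m ⟨hm, hm'⟩
      obtain ⟨_, ⟨v, hv, rfl⟩, u, hu, rfl⟩ := Submodule.mem_sup.1 hm'
      rw [← comp_same hM hm, map_add]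
      refine add_mem (Submodule.mem_sup_left ⟨comp hM (j - d) v, ⟨comp_mem hM _ _, hV v hv _⟩, ?_⟩)
        (Submodule.mem_sup_right ⟨comp_mem hM _ _, hU u hu _⟩)
      exact (comp_smul hM ha j v).symm
    · refine sup_le ?_ fun u hu => ⟨hu.1, Submodule.mem_sup_right hu.2⟩
      rintro _ ⟨v, hv, rfl⟩
      exact ⟨ha' v hv.1, Submodule.mem_sup_left ⟨v, hv.2, rfl⟩⟩
  have h2 : (part ℳ (U.comap (LinearMap.lsmul A M a) ⊓ V) (j - d)).map (mulMap k M a) =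
      (part ℳ V (j - d)).map (mulMap k M a) ⊓ part ℳ U j := by
    apply le_antisymm
    · rintro _ ⟨v, ⟨hv, hv1, hv2⟩, rfl⟩
      exact ⟨⟨v, ⟨hv, hv2⟩, rfl⟩, ha' v hv, hv1⟩
    · rintro _ ⟨⟨v, ⟨hv, hv2⟩, rfl⟩, h3, h4⟩
      exact ⟨v, ⟨hv, h4, hv2⟩, rfl⟩
  have h3 : part ℳ (U.comap (LinearMap.lsmul A M a) ⊓ V) (j - d) ⊓ LinearMap.ker (mulMap k M a) =
      part ℳ V (j - d) ⊓ LinearMap.ker (mulMap k M a) := by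
    apply le_antisymm
    · rintro v ⟨⟨hv, hv1, hv2⟩, h⟩
      exact ⟨⟨hv, hv2⟩, h⟩
    · rintro v ⟨⟨hv, hv2⟩, h⟩
      refine ⟨⟨hv, ?_, hv2⟩, h⟩
      change a • v ∈ U
      rw [show a • v = 0 from h]
      exact zero_mem _
  have e1 := Submodule.finrank_sup_add_finrank_inf_eq
    ((part ℳ V (j - d)).map (mulMap k M a)) (part ℳ U j)
  have e2 := finrank_map_add_inf_ker (mulMap k M a) (part ℳ V (j - d))
  have e3 := finrank_map_add_inf_ker (mulMap k M a)
    (part ℳ (U.comap (LinearMap.lsmul A M a) ⊓ V) (j - d))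
  rw [h2, h3] at e3
  rw [← h1] at e1
  simp only [hilbertFun]
  rw [← e2, ← e3]
  push_cast
  have e1' : (Module.finrank k (part ℳ (V.map (LinearMap.lsmul A M a) ⊔ U) j) : ℚ) +
      Module.finrank k ((part ℳ V (j - d)).map (mulMap k M a) ⊓ part ℳ U j : Submodule k M) =
      Module.finrank k ((part ℳ V (j - d)).map (mulMap k M a)) + Module.finrank k (part ℳ U j) := by
    exact_mod_cast e1
  linarith

/-- If all the `x i` kill V/U, then V/U is spanned over k by the classes of finitely many
generators, so it lives in the finitely many degrees that occur in these. This is the base case of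
Hilbert–Serre. -/
theorem exists_finset_part_le (hx : Algebra.adjoin k (Set.range x) = ⊤)
    (hM : DirectSum.IsInternal ℳ)
    (hxM : ∀ i j, ∀ m ∈ ℳ j, x i • m ∈ ℳ (j + w i)) [IsNoetherian A M] {U V : Submodule A M}
    (hV : IsHomog hM V) (h : ∀ i, ∀ v ∈ V, x i • v ∈ U) :
    ∃ J : Finset ℤ, ∀ j ∉ J, part ℳ V j ≤ part ℳ U j := by
  classical
  obtain ⟨T, hT⟩ := IsNoetherian.noetherian V
  choose s hs1 hs2 using exists_eq_sum_comp hM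
  refine ⟨T.biUnion s, ?_⟩
  let P : Submodule k M := V.restrictScalars k ⊓
    ⨅ j, ⨅ (_ : j ∉ T.biUnion s), (U.restrictScalars k).comap (comp hM j)
  have hP : ∀ m, m ∈ P ↔ m ∈ V ∧ ∀ j ∉ T.biUnion s, comp hM j m ∈ U := fun m => by
    simp only [P, Submodule.mem_inf, Submodule.mem_iInf]
    rfl
  have hPx : ∀ i, ∀ m ∈ P, x i • m ∈ P := by
    intro i m hm
    rw [hP] at hm ⊢
    refine ⟨V.smul_mem _ hm.1, fun j _ => ?_⟩
    rw [comp_smul hM (hxM i)]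
    exact h i _ (hV m hm.1 _)
  let P' : Submodule A M :=
    { P with smul_mem' := fun a m hm => smul_mem_of_adjoin_eq_top hx P hPx a hm }
  have hle : V ≤ P' := by
    rw [← hT, Submodule.span_le]
    intro t ht
    refine (hP t).2 ⟨hT ▸ Submodule.subset_span ht, fun j hj => ?_⟩
    rw [hs1 t j fun h => hj (Finset.mem_biUnion.2 ⟨t, ht, h⟩)]
    exact zero_mem _
  rintro j hj m ⟨hm, hm'⟩
  have := ((hP m).1 (hle hm')).2 j hj
  rw [comp_same hM hm] at this
  exact ⟨hm, this⟩

/-- Hilbert–Serre for a subquotient V/U, by induction on the set S of variables that may act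
nontrivially. For a in S, the kernel ((U : x_a) ∩ V)/U and the cokernel V/(x_a V + U) of
multiplication by x_a are killed by x_a, so the induction hypothesis applies to both. They determine
(1 - t^{w a}) H(V/U). -/
theorem exists_isGenFun_quotient [Fintype ι] (hx : Algebra.adjoin k (Set.range x) = ⊤)
    (hw : ∀ i, 0 < w i) (hM : DirectSum.IsInternal ℳ)
    (hxM : ∀ i j, ∀ m ∈ ℳ j, x i • m ∈ ℳ (j + w i)) [IsNoetherian A M] (S : Finset ι) :
    ∀ U V : Submodule A M, IsHomog hM U → IsHomog hM V → U ≤ V →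
      (∀ i ∉ S, ∀ v ∈ V, x i • v ∈ U) →
      ∃ φ, IsGenFun φ fun j => hilbertFun (part ℳ V) j - hilbertFun (part ℳ U) j := by
  classical
  have hfin := finite_component hx hw hM hxM
  obtain ⟨b, hb⟩ := exists_component_eq_bot hx hw hM hxM
  induction S using Finset.induction_on with
  | empty =>
    intro U V hU hV hUV h
    obtain ⟨J, hJ⟩ := exists_finset_part_le hx hM hxM hV (fun i => h i (by simp))
    refine exists_isGenFun_of_finite_support J fun j hj => ?_
    have : part ℳ V j = part ℳ U j :=
      le_antisymm (hJ j hj) fun m hm => ⟨hm.1, hUV hm.2⟩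
    rw [hilbertFun_congr this, sub_self]
  | insert a S ha ih =>
    intro U V hU hV hUV h
    set X := LinearMap.lsmul A M (x a) with hX
    have hXc : ∀ j m, comp hM j (X m) = X (comp hM (j - w a) m) := fun j m =>
      comp_smul hM (hxM a) j m
    have hle1 : V.map X ⊔ U ≤ V := sup_le (by
      rintro _ ⟨v, hv, rfl⟩
      exact V.smul_mem _ hv) hUV
    have hle2 : U ≤ U.comap X ⊓ V := le_inf (fun u hu => U.smul_mem _ hu) hUV
    have hh1 : IsHomog hM (V.map X ⊔ U) := by
      intro m hm j
      obtain ⟨_, ⟨v, hv, rfl⟩, u, hu, rfl⟩ := Submodule.mem_sup.1 hm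
      rw [map_add, hXc]
      exact add_mem (Submodule.mem_sup_left ⟨_, hV v hv _, rfl⟩)
        (Submodule.mem_sup_right (hU u hu _))
    have hh2 : IsHomog hM (U.comap X ⊓ V) := by
      rintro m ⟨hm, hm'⟩ j
      refine ⟨?_, hV m hm' j⟩
      have := hU _ hm (j + w a)
      rw [hXc, add_sub_cancel_right] at this
      exact this
    obtain ⟨φ, hφ⟩ := ih (V.map X ⊔ U) V hh1 hV hle1 (by
      intro i hi v hv
      by_cases hia : i = a
      · subst hia
        exact Submodule.mem_sup_left ⟨v, hv, rfl⟩
      · exact Submodule.mem_sup_right (h i (by simp [hia, hi]) v hv))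
    obtain ⟨ψ, hψ⟩ := ih U (U.comap X ⊓ V) hU hh2 hle2 (by
      rintro i hi v ⟨hv, hv'⟩
      by_cases hia : i = a
      · subst hia
        exact hv
      · exact h i (by simp [hia, hi]) v hv')
    refine exists_isGenFun_of_sub_shift b ?_ (hw a) (hφ.sub (hψ.shift (w a))) ?_
    · intro j hj
      have : ∀ W : Submodule A M, part ℳ W j = ⊥ := fun W => by
        rw [part, hb j hj, bot_inf_eq]
      rw [hilbertFun_eq_zero (this V), hilbertFun_eq_zero (this U), sub_self]
    · intro j
      have := finrank_part_sup_smul hM hfin hU hV (hxM a) j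
      rw [← hX] at this
      linarith

/-- **Hilbert–Serre theorem** for a homogeneous submodule of a finitely generated graded module. -/
theorem exists_isGenFun_part [Fintype ι] (hx : Algebra.adjoin k (Set.range x) = ⊤)
    (hw : ∀ i, 0 < w i) (hM : DirectSum.IsInternal ℳ)
    (hxM : ∀ i j, ∀ m ∈ ℳ j, x i • m ∈ ℳ (j + w i)) [IsNoetherian A M] {V : Submodule A M}
    (hV : IsHomog hM V) : ∃ φ, IsGenFun φ (hilbertFun (part ℳ V)) := by
  obtain ⟨φ, hφ⟩ := exists_isGenFun_quotient hx hw hM hxM Finset.univ ⊥ V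
    (fun v hv j => by simp [(Submodule.mem_bot A).1 hv]) hV bot_le (by simp)
  refine ⟨φ, hφ.congr fun j => ?_⟩
  have : part ℳ (⊥ : Submodule A M) j = ⊥ := by
    rw [eq_bot_iff]
    exact fun m hm => hm.2
  rw [hilbertFun_eq_zero this, sub_zero]

/-- **Hilbert–Serre theorem**. -/
theorem hasRationalHilbertSeries_of_noetherian [Fintype ι]
    (hx : Algebra.adjoin k (Set.range x) = ⊤) (hw : ∀ i, 0 < w i) (hM : DirectSum.IsInternal ℳ)
    (hxM : ∀ i j, ∀ m ∈ ℳ j, x i • m ∈ ℳ (j + w i)) [IsNoetherian A M] :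
    HasRationalHilbertSeries ℳ := by
  obtain ⟨φ, hφ⟩ := exists_isGenFun_part hx hw hM hxM (V := ⊤) fun _ _ _ => Submodule.mem_top
  refine ⟨φ, finite_component hx hw hM hxM, hφ.congr fun j => ?_⟩
  have : part ℳ (⊤ : Submodule A M) j = ℳ j := by
    rw [part, Submodule.restrictScalars_top, inf_top_eq]
  exact hilbertFun_congr this

end HilbertSerre

/-! ### Graded algebras generated in positive degrees -/

/-- `A` is a graded algebra generated by elements `x i` of positive degrees `w i`. -/
structure IsPosGraded {k : Type*} [Field k] {A : Type*} [CommRing A] [Algebra k A]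
    (𝒜 : ℤ → Submodule k A) {ι : Type*} (x : ι → A) (w : ι → ℤ) : Prop where
  graded : IsGradedModule 𝒜 𝒜
  one_mem : (1 : A) ∈ 𝒜 0
  adjoin : Algebra.adjoin k (Set.range x) = ⊤
  pos : ∀ i, 0 < w i
  mem : ∀ i, x i ∈ 𝒜 (w i)

/-! ### The graded complete intersection ring and relations among the f_m -/

section QuotRing

variable {k : Type*} [Field k] {ν c : ℕ} {w : Fin ν → ℤ} {f : Fin c → MvPolynomial (Fin ν) k}
  {e : Fin c → ℤ}

theorem isInternal_weightedHomogeneousSubmodule (w : Fin ν → ℤ) :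
    DirectSum.IsInternal (MvPolynomial.weightedHomogeneousSubmodule k w) :=
  letI := MvPolynomial.weightedDecomposition k w
  DirectSum.Decomposition.isInternal _

theorem comp_mul_of_mem {p q : MvPolynomial (Fin ν) k} {d : ℤ}
    (hq : MvPolynomial.IsWeightedHomogeneous w q d) (j : ℤ) :
    comp (isInternal_weightedHomogeneousSubmodule w) j (p * q) =
      comp (isInternal_weightedHomogeneousSubmodule w) (j - d) p * q := by
  have := comp_smul (isInternal_weightedHomogeneousSubmodule (k := k) w) (a := q) (d := d)
    (fun i m hm => by
      rw [smul_eq_mul, add_comm]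
      exact hq.mul hm) j p
  rw [mul_comm p, mul_comm _ q]
  exact this

theorem comp_mem_span (hf : ∀ m, MvPolynomial.IsWeightedHomogeneous w (f m) (e m))
    {p : MvPolynomial (Fin ν) k} (hp : p ∈ Ideal.span (Set.range f)) (j : ℤ) :
    comp (isInternal_weightedHomogeneousSubmodule w) j p ∈ Ideal.span (Set.range f) := by
  obtain ⟨u, rfl⟩ := (Ideal.mem_span_range_iff_exists_fun).1 hp
  rw [map_sum]
  refine Ideal.sum_mem _ fun m _ => ?_
  rw [comp_mul_of_mem (hf m)]
  exact Ideal.mul_mem_left _ _ (Ideal.subset_span ⟨m, rfl⟩)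

theorem isInternal_quotGrading (hf : ∀ m, MvPolynomial.IsWeightedHomogeneous w (f m) (e m)) :
    DirectSum.IsInternal (quotGrading w f) := by
  refine isInternal_map (isInternal_weightedHomogeneousSubmodule w)
    (Ideal.Quotient.mkₐ k (Ideal.span (Set.range f))).toLinearMap
    (Ideal.Quotient.mkₐ_surjective k _) ?_
  intro p hp j
  exact Ideal.Quotient.eq_zero_iff_mem.2 (comp_mem_span hf (Ideal.Quotient.eq_zero_iff_mem.1 hp) j)

theorem mk_mem_quotGrading {p : MvPolynomial (Fin ν) k} {d : ℤ}
    (hp : MvPolynomial.IsWeightedHomogeneous w p d) :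
    Ideal.Quotient.mk (Ideal.span (Set.range f)) p ∈ quotGrading w f d := ⟨p, hp, rfl⟩

theorem IsCompleteIntersection.isPosGraded (h : IsCompleteIntersection w f e) :
    IsPosGraded (quotGrading w f)
      (fun i => Ideal.Quotient.mk (Ideal.span (Set.range f)) (MvPolynomial.X i)) w where
  graded :=
    { isInternal := isInternal_quotGrading h.homogeneous
      smul_mem := by
        rintro i j _ _ ⟨p, hp, rfl⟩ ⟨q, hq, rfl⟩
        exact ⟨p * q, hp.mul hq, map_mul (Ideal.Quotient.mk _) p q⟩ }
  one_mem := ⟨1, MvPolynomial.isWeightedHomogeneous_one k w, map_one (Ideal.Quotient.mk _)⟩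
  adjoin := by
    have h1 := congrArg (Subalgebra.map (Ideal.Quotient.mkₐ k (Ideal.span (Set.range f))))
      (MvPolynomial.adjoin_range_X (R := k) (σ := Fin ν))
    rw [AlgHom.map_adjoin, ← Set.range_comp, Algebra.map_top,
      (AlgHom.range_eq_top _).2 (Ideal.Quotient.mkₐ_surjective _ _)] at h1
    exact h1
  pos := h.weight_pos
  mem i := mk_mem_quotGrading (MvPolynomial.isWeightedHomogeneous_X k w i)

theorem IsCompleteIntersection.nontrivial_quotRing (h : IsCompleteIntersection w f e) :
    Nontrivial (QuotRing f) := by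
  have h1 := h.regular.top_ne_smul
  refine Ideal.Quotient.nontrivial_iff.2 fun h2 => h1 ?_
  have : Ideal.ofList (List.ofFn f) = Ideal.span (Set.range f) := by
    rw [Ideal.ofList]
    congr 1
    ext p
    simp [List.mem_ofFn]
  rw [this, h2]
  simp

/-- The relations between the members of a weakly regular sequence have coefficients in the ideal
generated by the sequence. -/
theorem mem_span_of_sum_mul_eq_zero {Q : Type*} [CommRing Q] {c : ℕ} (f : Fin c → Q)
    (hf : ∀ m : Fin c, ∀ u, f m * u ∈ Ideal.span (f '' {l | l < m}) →
      u ∈ Ideal.span (f '' {l | l < m}))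
    (u : Fin c → Q) (hu : ∑ m, f m * u m = 0) (m : Fin c) : u m ∈ Ideal.span (Set.range f) := by
  induction c with
  | zero => exact m.elim0
  | succ c ih =>
    have himg : ∀ m : Fin c, f '' {l | l < m.castSucc} =
        (fun l : Fin c => f l.castSucc) '' {l | l < m} := by
      intro m
      ext q
      constructor
      · rintro ⟨l, hl, rfl⟩
        refine ⟨⟨l, lt_trans (Fin.lt_def.1 hl) m.2⟩, hl, rfl⟩
      · rintro ⟨l, hl, rfl⟩
        exact ⟨l.castSucc, hl, rfl⟩
    have hlast : f '' {l | l < Fin.last c} = Set.range fun l : Fin c => f l.castSucc := by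
      ext q
      constructor
      · rintro ⟨l, hl, rfl⟩
        exact ⟨⟨l, Fin.lt_def.1 hl⟩, rfl⟩
      · rintro ⟨l, rfl⟩
        exact ⟨l.castSucc, Fin.castSucc_lt_last l, rfl⟩
    have hsub : Ideal.span (Set.range fun l : Fin c => f l.castSucc) ≤
        Ideal.span (Set.range f) :=
      Ideal.span_mono (by rintro _ ⟨l, rfl⟩; exact ⟨_, rfl⟩)
    rw [Fin.sum_univ_castSucc] at hu
    have h1 : u (Fin.last c) ∈ Ideal.span (Set.range fun l : Fin c => f l.castSucc) := by
      rw [← hlast]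
      apply hf
      rw [hlast, eq_neg_of_add_eq_zero_right hu]
      exact neg_mem (Ideal.sum_mem _ fun l _ =>
        Ideal.mul_mem_right _ _ (Ideal.subset_span ⟨l, rfl⟩))
    -- Regularity puts the last coefficient in the ideal of the earlier f_l. Substituting Σ v_l f_l
    -- for it gives a relation of length c with coefficients u_l + f_c v_l, and the correction f_c
    -- v_l lies in the ideal anyway.
    obtain ⟨v, hv⟩ := Ideal.mem_span_range_iff_exists_fun.1 h1
    have h2 := ih (fun l => f l.castSucc) (fun m u hu => by
        have := hf m.castSucc u
        rw [himg] at this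
        exact this hu)
      (fun l => u l.castSucc + f (Fin.last c) * v l) (by
        rw [← hu, ← hv, Finset.mul_sum, ← Finset.sum_add_distrib]
        exact Finset.sum_congr rfl fun l _ => by ring)
    refine Fin.lastCases (hsub h1) (fun l => ?_) m
    have h3 : f (Fin.last c) * v l ∈ Ideal.span (Set.range f) :=
      Ideal.mul_mem_right _ _ (Ideal.subset_span ⟨_, rfl⟩)
    exact (Submodule.add_mem_iff_left _ h3).1 (hsub (h2 l))

theorem IsCompleteIntersection.mem_span_of_sum_mul_eq_zero (h : IsCompleteIntersection w f e)
    (u : Fin c → MvPolynomial (Fin ν) k) (hu : ∑ m, f m * u m = 0) (m : Fin c) :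
    u m ∈ Ideal.span (Set.range f) := by
  refine GradedExt.mem_span_of_sum_mul_eq_zero f (fun m u hmu => ?_) u hu m
  have h1 := (RingTheory.Sequence.isWeaklyRegular_iff_Fin _ _).1 h.regular.toIsWeaklyRegular
    ⟨m, by simp⟩
  have h2 : Ideal.ofList (List.take m (List.ofFn f)) = Ideal.span (f '' {l | l < m}) := by
    rw [Ideal.ofList]
    congr 1
    ext p
    simp only [Set.mem_ofPred_eq, List.mem_take_iff_getElem, List.getElem_ofFn, Set.mem_image]
    constructor
    · rintro ⟨i, hi, rfl⟩
      simp only [List.length_ofFn, lt_inf_iff] at hi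
      exact ⟨⟨i, hi.2⟩, hi.1, rfl⟩
    · rintro ⟨l, hl, rfl⟩
      exact ⟨l, by simpa using hl, rfl⟩
  have h3 : (Ideal.ofList (List.take m (List.ofFn f)) • ⊤ :
      Submodule (MvPolynomial (Fin ν) k) (MvPolynomial (Fin ν) k)) =
      Ideal.span (f '' {l | l < m}) := by
    rw [h2]; simp
  rw [isSMulRegular_iff_right_eq_zero_of_smul] at h1
  have h4 := h1 (Submodule.Quotient.mk u) (by
    rw [← Submodule.Quotient.mk_smul, Submodule.Quotient.mk_eq_zero, h3]
    rw [show (List.ofFn f)[(⟨m, by simp⟩ : Fin (List.ofFn f).length)] = f m by simp]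
    exact hmu)
  rw [Submodule.Quotient.mk_eq_zero, h3] at h4
  exact h4

end QuotRing

/-! ### Graded free modules and homomorphisms -/

section Free

variable {k : Type*} [Field k] {A : Type*} [CommRing A] [Algebra k A] {𝒜 : ℤ → Submodule k A}
  {ι : Type*} {x : ι → A} {w : ι → ℤ}
  {P : Type*} [AddCommGroup P] [Module k P] [Module A P]
  {W : Type*} [AddCommGroup W] [Module k W] [Module A W]
  {N : Type*} [AddCommGroup N] [Module k N] [Module A N] [IsScalarTower k A N]
  {𝒳 : ℤ → Submodule k P} {𝒲 : ℤ → Submodule k W} {𝒩 : ℤ → Submodule k N}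

variable (A) in
/-- The homomorphisms between graded modules that are homogeneous of degree `j`. -/
def homDeg (𝒳 : ℤ → Submodule k P) (𝒩 : ℤ → Submodule k N) (j : ℤ) :
    Submodule k (P →ₗ[A] N) where
  carrier := {φ | ∀ l : ℤ, ∀ v ∈ 𝒳 l, φ v ∈ 𝒩 (l + j)}
  add_mem' h h' l v hv := (𝒩 (l + j)).add_mem (h l v hv) (h' l v hv)
  zero_mem' l _ _ := (𝒩 (l + j)).zero_mem
  smul_mem' c _ h l v hv := (𝒩 (l + j)).smul_mem c (h l v hv)

theorem mem_freeGrading {r : ℕ} {a : Fin r → ℤ} {j : ℤ} {v : Fin r → A} :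
    v ∈ freeGrading 𝒜 a j ↔ ∀ p, v p ∈ 𝒜 (j - a p) := mem_shiftPi

theorem single_mem_freeGrading (hA : IsPosGraded 𝒜 x w) {r : ℕ} (a : Fin r → ℤ) (p : Fin r) :
    Pi.single p 1 ∈ freeGrading 𝒜 a (a p) := by
  refine mem_freeGrading.2 fun q => ?_
  by_cases h : q = p
  · subst h; simpa using hA.one_mem
  · simp [Pi.single_eq_of_ne h]

theorem isGradedModule_freeGrading (hA : IsPosGraded 𝒜 x w) {r : ℕ} (a : Fin r → ℤ) :
    IsGradedModule 𝒜 (freeGrading 𝒜 a) where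
  isInternal := isInternal_shiftPi hA.graded.isInternal a
  smul_mem {i j b m} hb hm := mem_freeGrading.2 fun p => by
    have := hA.graded.smul_mem hb (mem_freeGrading.1 hm p)
    rwa [← add_sub_assoc] at this

/-- A linear map on a graded free module that is homogeneous on the basis is homogeneous. -/
theorem map_mem_of_single {r : ℕ} {a : Fin r → ℤ}
    (hW : ∀ {i j : ℤ} {b : A} {m : W}, b ∈ 𝒜 i → m ∈ 𝒲 j → b • m ∈ 𝒲 (i + j))
    {g : (Fin r → A) →ₗ[A] W} {d : ℤ} (hg : ∀ p, g (Pi.single p 1) ∈ 𝒲 (a p + d)) {l : ℤ}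
    {v : Fin r → A} (hv : v ∈ freeGrading 𝒜 a l) : g v ∈ 𝒲 (l + d) := by
  rw [LinearMap.pi_apply_eq_sum_univ g v]
  refine Submodule.sum_mem _ fun p _ => ?_
  have h1 := hW (mem_freeGrading.1 hv p) (hg p)
  rw [show l - a p + (a p + d) = l + d by ring] at h1
  convert h1 using 3
  ext q
  simp [Pi.single_apply, eq_comm]

theorem mem_homDeg_freeGrading (hA : IsPosGraded 𝒜 x w) (hN : IsGradedModule 𝒜 𝒩) {r : ℕ}
    {a : Fin r → ℤ} {j : ℤ} {φ : (Fin r → A) →ₗ[A] N} :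
    φ ∈ homDeg A (freeGrading 𝒜 a) 𝒩 j ↔ ∀ p, φ (Pi.single p 1) ∈ 𝒩 (a p + j) :=
  ⟨fun h p => h _ _ (single_mem_freeGrading hA a p),
    fun h _ _ hv => map_mem_of_single hN.smul_mem h hv⟩

/-- A map of degree j sends the p-th basis vector to degree a p + j = j - (-a p); hence the grading
of N^r with shifts -a. -/
theorem homDeg_freeGrading_eq_map (hA : IsPosGraded 𝒜 x w) (hN : IsGradedModule 𝒜 𝒩) {r : ℕ}
    (a : Fin r → ℤ) :
    homDeg A (freeGrading 𝒜 a) 𝒩 = fun j => (shiftPi 𝒩 (-a) j).map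
      ((Pi.basisFun A (Fin r)).constr k : (Fin r → N) ≃ₗ[k] _).toLinearMap := by
  funext j
  have hc : ∀ (v : Fin r → N) p,
      (Pi.basisFun A (Fin r)).constr k v (Pi.single p 1) = v p := fun v p => by
    rw [← Pi.basisFun_apply, Module.Basis.constr_basis]
  ext φ
  rw [mem_homDeg_freeGrading hA hN]
  constructor
  · intro h
    refine ⟨fun p => φ (Pi.single p 1), mem_shiftPi.2 fun p => ?_, ?_⟩
    · simpa [add_comm] using h p
    · refine (Pi.basisFun A (Fin r)).ext fun p => ?_
      rw [Pi.basisFun_apply]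
      exact hc _ _
  · rintro ⟨v, hv, rfl⟩ p
    have := mem_shiftPi.1 hv p
    simp only [LinearEquiv.coe_coe, hc]
    simpa [add_comm] using this

theorem isInternal_homDeg (hA : IsPosGraded 𝒜 x w) (hN : IsGradedModule 𝒜 𝒩) {r : ℕ}
    (a : Fin r → ℤ) : DirectSum.IsInternal (homDeg A (freeGrading 𝒜 a) 𝒩) := by
  rw [homDeg_freeGrading_eq_map hA hN]
  refine isInternal_map (isInternal_shiftPi hN.isInternal _) _ (LinearEquiv.surjective _) ?_
  intro v hv j
  rw [LinearEquiv.coe_coe, LinearEquiv.map_eq_zero_iff] at hv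
  rw [hv, map_zero, map_zero]

theorem smul_mem_homDeg (hN : IsGradedModule 𝒜 𝒩) {b : A} {d j : ℤ} (hb : b ∈ 𝒜 d)
    {φ : P →ₗ[A] N} (hφ : φ ∈ homDeg A 𝒳 𝒩 j) : b • φ ∈ homDeg A 𝒳 𝒩 (j + d) := by
  intro l v hv
  have := hN.smul_mem hb (hφ l v hv)
  rwa [show d + (l + j) = l + (j + d) by ring] at this

theorem finite_homDeg (hA : IsPosGraded 𝒜 x w) (hN : IsGradedModule 𝒜 𝒩)
    (hfin : ∀ j, Module.Finite k (𝒩 j)) {r : ℕ} (a : Fin r → ℤ) (j : ℤ) :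
    Module.Finite k (homDeg A (freeGrading 𝒜 a) 𝒩 j) := by
  rw [homDeg_freeGrading_eq_map hA hN]
  have := finite_shiftPi hfin (-a) j
  infer_instance

theorem hilbertFun_homDeg (hA : IsPosGraded 𝒜 x w) (hN : IsGradedModule 𝒜 𝒩)
    (hfin : ∀ j, Module.Finite k (𝒩 j)) {r : ℕ} (a : Fin r → ℤ) (j : ℤ) :
    hilbertFun (homDeg A (freeGrading 𝒜 a) 𝒩) j = ∑ p, hilbertFun 𝒩 (j + a p) := by
  rw [homDeg_freeGrading_eq_map hA hN]
  have := finite_shiftPi hfin (-a) j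
  unfold hilbertFun
  rw [finrank_map_of_injOn, finrank_shiftPi hfin]
  · push_cast
    exact Finset.sum_congr rfl fun p _ => hilbertFun_congr (by simp)
  · intro v _ hv
    simpa using hv

theorem hilbertFun_freeGrading (hfin : ∀ j, Module.Finite k (𝒜 j)) {r : ℕ} (a : Fin r → ℤ)
    (j : ℤ) : hilbertFun (freeGrading 𝒜 a) j = ∑ p, hilbertFun 𝒜 (j - a p) := by
  unfold hilbertFun
  exact_mod_cast congrArg (Nat.cast (R := ℚ)) (finrank_shiftPi hfin a j)

theorem IsPosGraded.smul_mem (hA : IsPosGraded 𝒜 x w) (hN : IsGradedModule 𝒜 𝒩) (i : ι) (j : ℤ)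
    (m : N) (hm : m ∈ 𝒩 j) : x i • m ∈ 𝒩 (j + w i) := by
  rw [add_comm]
  exact hN.smul_mem (hA.mem i) hm

theorem IsPosGraded.hasRationalHilbertSeries [Fintype ι] [IsNoetherianRing A] [Module.Finite A N]
    (hA : IsPosGraded 𝒜 x w) (hN : IsGradedModule 𝒜 𝒩) : HasRationalHilbertSeries 𝒩 :=
  hasRationalHilbertSeries_of_noetherian hA.adjoin hA.pos hN.isInternal (hA.smul_mem hN)

/-- The Laurent polynomial `∑ p, t ^ (a p)`. -/
def degPoly {r : ℕ} (a : Fin r → ℤ) : RatFunc ℚ := ∑ p, RatFunc.X ^ a p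

theorem invVarHom_degPoly {r : ℕ} (a : Fin r → ℤ) :
    invVarHom (degPoly a) = ∑ p, RatFunc.X ^ (-a p) := by
  simp only [degPoly, map_sum, invVarHom_zpow_X]

theorem isGenFun_freeGrading (hfin : ∀ j, Module.Finite k (𝒜 j)) {r : ℕ} (a : Fin r → ℤ)
    {φ : RatFunc ℚ} (hφ : IsGenFun φ (hilbertFun 𝒜)) :
    IsGenFun (degPoly a * φ) (hilbertFun (freeGrading 𝒜 a)) := by
  rw [degPoly, Finset.sum_mul]
  exact (IsGenFun.sum _ fun p _ => hφ.shift (a p)).congr fun j =>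
    (hilbertFun_freeGrading hfin a j).symm

/-- Dualizing negates the degrees of the basis. This is the origin of the substitution t ↦ t⁻¹ in
the correction term of ρ. -/
theorem isGenFun_homDeg (hA : IsPosGraded 𝒜 x w) (hN : IsGradedModule 𝒜 𝒩)
    (hfin : ∀ j, Module.Finite k (𝒩 j)) {r : ℕ} (a : Fin r → ℤ)
    {φ : RatFunc ℚ} (hφ : IsGenFun φ (hilbertFun 𝒩)) :
    IsGenFun (invVarHom (degPoly a) * φ) (hilbertFun (homDeg A (freeGrading 𝒜 a) 𝒩)) := by
  rw [invVarHom_degPoly, Finset.sum_mul]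
  exact (IsGenFun.sum _ fun p _ => hφ.shift (-a p)).congr fun j => by
    rw [hilbertFun_homDeg hA hN hfin]
    simp

end Free

/-! ### Hilbert functions in a free resolution -/

namespace FreeResolution

variable {k : Type*} [Field k] {A : Type*} [CommRing A] [Algebra k A] {𝒜 : ℤ → Submodule k A}
  {ι : Type*} {x : ι → A} {w : ι → ℤ}
  {M : Type*} [AddCommGroup M] [Module k M] [Module A M]
  {ℳ : ℤ → Submodule k M}
  {N : Type*} [AddCommGroup N] [Module k N] [Module A N] [IsScalarTower k A N]
  {𝒩 : ℤ → Submodule k N} (F : FreeResolution 𝒜 ℳ)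

theorem diff_mem (hA : IsPosGraded 𝒜 x w) (i : ℕ) (l : ℤ) (v : F.Obj (i + 1))
    (hv : v ∈ freeGrading 𝒜 (F.deg (i + 1)) l) : F.diff i v ∈ freeGrading 𝒜 (F.deg i) l := by
  have := map_mem_of_single (isGradedModule_freeGrading hA (F.deg i)).smul_mem (g := F.diff i)
    (d := 0) (fun q => mem_freeGrading.2 fun p => by
      simpa [diff, Matrix.mulVec_single] using F.d_mem i p q) hv
  simpa using this

theorem aug_mem' (hM : IsGradedModule 𝒜 ℳ) (l : ℤ) (v : F.Obj 0)
    (hv : v ∈ freeGrading 𝒜 (F.deg 0) l) : F.aug v ∈ ℳ l := by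
  have := map_mem_of_single hM.smul_mem (g := F.aug) (d := 0)
    (fun q => by simpa using F.aug_mem q) hv
  simpa using this

theorem diff_diff (i : ℕ) (v : F.Obj (i + 2)) : F.diff i (F.diff (i + 1) v) = 0 :=
  (F.exact i).apply_apply_eq_zero v

theorem exists_of_diff_eq_zero {i : ℕ} {v : F.Obj (i + 1)} (hv : F.diff i v = 0) :
    ∃ u, F.diff (i + 1) u = v :=
  (F.exact i v).1 hv

/-- The homogeneous boundaries of degree `j` in `F_i`. -/
def bdry (i : ℕ) : ℤ → Submodule k (F.Obj i) :=
  part (freeGrading 𝒜 (F.deg i)) (LinearMap.range (F.diff i))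

theorem map_diff (hA : IsPosGraded 𝒜 x w) (i : ℕ) (j : ℤ) :
    (freeGrading 𝒜 (F.deg (i + 1)) j).map ((F.diff i).restrictScalars k) = F.bdry i j :=
  map_eq_inf_range (isGradedModule_freeGrading hA (F.deg (i + 1))).isInternal
    (isGradedModule_freeGrading hA (F.deg i)).isInternal ((F.diff i).restrictScalars k)
    (F.diff_mem hA i) j

theorem finite_freeGrading (hfin : ∀ j, Module.Finite k (𝒜 j)) (i : ℕ) (j : ℤ) :
    Module.Finite k (freeGrading 𝒜 (F.deg i) j) := finite_shiftPi hfin _ _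

theorem hilbertFun_freeGrading_zero [IsScalarTower k A M] (hA : IsPosGraded 𝒜 x w) (hfin : ∀ j, Module.Finite k (𝒜 j))
    (hM : IsGradedModule 𝒜 ℳ) (j : ℤ) :
    hilbertFun (freeGrading 𝒜 (F.deg 0)) j = hilbertFun ℳ j + hilbertFun (F.bdry 0) j := by
  have := F.finite_freeGrading hfin 0 j
  have h := finrank_map_add_inf_ker (F.aug.restrictScalars k) (freeGrading 𝒜 (F.deg 0) j)
  have h1 : (freeGrading 𝒜 (F.deg 0) j).map (F.aug.restrictScalars k) = ℳ j := by
    rw [map_eq_inf_range (isGradedModule_freeGrading hA (F.deg 0)).isInternal hM.isInternal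
      (F.aug.restrictScalars k) (F.aug_mem' hM), LinearMap.range_eq_top.2
        (show Function.Surjective (F.aug.restrictScalars k) from F.aug_surjective), inf_top_eq]
  have h2 : freeGrading 𝒜 (F.deg 0) j ⊓ LinearMap.ker (F.aug.restrictScalars k) = F.bdry 0 j := by
    ext v
    exact and_congr_right fun _ => F.exact_aug v
  rw [h1, h2] at h
  unfold hilbertFun
  exact_mod_cast h.symm

theorem hilbertFun_freeGrading_succ (hA : IsPosGraded 𝒜 x w) (hfin : ∀ j, Module.Finite k (𝒜 j))
    (i : ℕ) (j : ℤ) : hilbertFun (freeGrading 𝒜 (F.deg (i + 1))) j =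
      hilbertFun (F.bdry i) j + hilbertFun (F.bdry (i + 1)) j := by
  have := F.finite_freeGrading hfin (i + 1) j
  have h := finrank_map_add_inf_ker ((F.diff i).restrictScalars k)
    (freeGrading 𝒜 (F.deg (i + 1)) j)
  have h2 : freeGrading 𝒜 (F.deg (i + 1)) j ⊓ LinearMap.ker ((F.diff i).restrictScalars k) =
      F.bdry (i + 1) j := by
    ext v
    exact and_congr_right fun _ => F.exact i v
  rw [F.map_diff hA, h2] at h
  unfold hilbertFun
  exact_mod_cast h.symm

/-! #### Cochains -/

/-- The homogeneous cocycles. -/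
def gradedCocycles (𝒩 : ℤ → Submodule k N) (i : ℕ) : ℤ → Submodule k (F.Obj i →ₗ[A] N) :=
  part (F.homGrading 𝒩 i) (F.cocycles N i)

/-- The homogeneous coboundaries. -/
def gradedCoboundaries (𝒩 : ℤ → Submodule k N) (i : ℕ) : ℤ → Submodule k (F.Obj i →ₗ[A] N) :=
  part (F.homGrading 𝒩 i) (F.coboundaries N i)

theorem mem_cocycles {i : ℕ} {φ : F.Obj i →ₗ[A] N} :
    φ ∈ F.cocycles N i ↔ φ ∘ₗ F.diff i = 0 := Iff.rfl

theorem coboundaries_le_cocycles (i : ℕ) : F.coboundaries N i ≤ F.cocycles N i := by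
  cases i with
  | zero => exact bot_le
  | succ i =>
    rintro _ ⟨ψ, rfl⟩
    rw [mem_cocycles]
    ext1 v
    refine LinearMap.ext fun a => ?_
    simp [F.diff_diff]

theorem comp_diff_mem (hA : IsPosGraded 𝒜 x w) (i : ℕ) (j : ℤ) (φ : F.Obj i →ₗ[A] N)
    (hφ : φ ∈ F.homGrading 𝒩 i j) : φ ∘ₗ F.diff i ∈ F.homGrading 𝒩 (i + 1) j :=
  fun l v hv => hφ l _ (F.diff_mem hA i l v hv)

theorem isInternal_homGrading (hA : IsPosGraded 𝒜 x w) (hN : IsGradedModule 𝒜 𝒩) (i : ℕ) :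
    DirectSum.IsInternal (F.homGrading 𝒩 i) := isInternal_homDeg hA hN (F.deg i)

theorem finite_homGrading (hA : IsPosGraded 𝒜 x w) (hN : IsGradedModule 𝒜 𝒩)
    (hfin : ∀ j, Module.Finite k (𝒩 j)) (i : ℕ) (j : ℤ) :
    Module.Finite k (F.homGrading 𝒩 i j) := finite_homDeg hA hN hfin (F.deg i) j

/-- Composition with the differential, as a linear map over the base field. -/
def codiff (N : Type*) [AddCommGroup N] [Module k N] [Module A N] [IsScalarTower k A N] (i : ℕ) :
    (F.Obj i →ₗ[A] N) →ₗ[k] (F.Obj (i + 1) →ₗ[A] N) :=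
  (LinearMap.lcomp A N (F.diff i)).restrictScalars k

theorem map_codiff (hA : IsPosGraded 𝒜 x w) (hN : IsGradedModule 𝒜 𝒩) (i : ℕ) (j : ℤ) :
    (F.homGrading 𝒩 i j).map (F.codiff N i) = F.gradedCoboundaries 𝒩 (i + 1) j :=
  map_eq_inf_range (F.isInternal_homGrading hA hN i) (F.isInternal_homGrading hA hN (i + 1))
    (F.codiff N i) (fun j φ hφ => F.comp_diff_mem hA i j φ hφ) j

theorem hilbertFun_homGrading (hA : IsPosGraded 𝒜 x w) (hN : IsGradedModule 𝒜 𝒩)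
    (hfin : ∀ j, Module.Finite k (𝒩 j)) (i : ℕ) (j : ℤ) :
    hilbertFun (F.homGrading 𝒩 i) j =
      hilbertFun (F.gradedCocycles 𝒩 i) j + hilbertFun (F.gradedCoboundaries 𝒩 (i + 1)) j := by
  have := F.finite_homGrading hA hN hfin i j
  have h := finrank_map_add_inf_ker (F.codiff N i) (F.homGrading 𝒩 i j)
  have h2 : F.homGrading 𝒩 i j ⊓ LinearMap.ker (F.codiff N i) = F.gradedCocycles 𝒩 i j := rfl
  rw [F.map_codiff hA hN, h2] at h
  unfold hilbertFun
  rw [← h]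
  push_cast
  ring

theorem finite_extGrading (hA : IsPosGraded 𝒜 x w) (hN : IsGradedModule 𝒜 𝒩)
    (hfin : ∀ j, Module.Finite k (𝒩 j)) (i : ℕ) (j : ℤ) :
    Module.Finite k (F.extGrading 𝒩 i j) := by
  have := F.finite_homGrading hA hN hfin i j
  have := finite_comap ((F.cocycles N i).subtype.restrictScalars k) Subtype.val_injective
    (F.homGrading 𝒩 i j)
  unfold extGrading
  infer_instance

/-- The grading of Ext lives on a quotient of the subtype of cocycles; the dimension count is
carried into Hom(F_i, N) along the inclusion `S`. -/
theorem hilbertFun_gradedCocycles (hA : IsPosGraded 𝒜 x w) (hN : IsGradedModule 𝒜 𝒩)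
    (hfin : ∀ j, Module.Finite k (𝒩 j)) (i : ℕ) (j : ℤ) :
    hilbertFun (F.gradedCocycles 𝒩 i) j =
      hilbertFun (F.extGrading 𝒩 i) j + hilbertFun (F.gradedCoboundaries 𝒩 i) j := by
  have := F.finite_homGrading hA hN hfin i j
  set S := (F.cocycles N i).subtype.restrictScalars k
  have hS : Function.Injective S := Subtype.val_injective
  set U := (F.homGrading 𝒩 i j).comap S
  have hU : Module.Finite k U := finite_comap S hS _
  set π := ((F.coboundaries N i).submoduleOf (F.cocycles N i)).mkQ.restrictScalars k
  have h := finrank_map_add_inf_ker π U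
  have h1 : U.map S = F.gradedCocycles 𝒩 i j := by
    ext φ
    constructor
    · rintro ⟨v, hv, rfl⟩
      exact ⟨hv, v.2⟩
    · rintro ⟨hφ, hφ'⟩
      exact ⟨⟨φ, hφ'⟩, hφ, rfl⟩
  have h2 : (U ⊓ LinearMap.ker π).map S = F.gradedCoboundaries 𝒩 i j := by
    have hker : ∀ v, π v = 0 ↔ (v : F.Obj i →ₗ[A] N) ∈ F.coboundaries N i := fun v =>
      Submodule.Quotient.mk_eq_zero _
    ext φ
    constructor
    · rintro ⟨v, ⟨hv, hv'⟩, rfl⟩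
      exact ⟨hv, (hker v).1 hv'⟩
    · rintro ⟨hφ, hφ'⟩
      exact ⟨⟨φ, F.coboundaries_le_cocycles i hφ'⟩, ⟨hφ, (hker _).2 hφ'⟩, rfl⟩
  have hfin2 : Module.Finite k (U ⊓ LinearMap.ker π : Submodule k _) := finite_of_le inf_le_left
  have e1 := finrank_map_of_injOn S U fun v _ hv => hS (hv.trans (map_zero S).symm)
  have e2 := finrank_map_of_injOn S (U ⊓ LinearMap.ker π) fun v _ hv =>
    hS (hv.trans (map_zero S).symm)
  rw [h1] at e1
  rw [h2] at e2
  unfold hilbertFun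
  rw [e1, e2, ← h]
  push_cast
  rfl

theorem gradedCoboundaries_zero (j : ℤ) : hilbertFun (F.gradedCoboundaries 𝒩 0) j = 0 :=
  hilbertFun_eq_zero (eq_bot_iff.2 fun _ h => h.2)

/-- Hom(F_i, N) is a Noetherian graded module, and the cocycles are a homogeneous submodule because
composition with ∂ preserves degrees. Hilbert–Serre applies directly. -/
theorem exists_isGenFun_gradedCocycles [Fintype ι] [IsNoetherianRing A] [Module.Finite A N]
    (hA : IsPosGraded 𝒜 x w) (hN : IsGradedModule 𝒜 𝒩) (i : ℕ) :
    ∃ φ, IsGenFun φ (hilbertFun (F.gradedCocycles 𝒩 i)) := by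
  refine exists_isGenFun_part (A := A) hA.adjoin hA.pos (F.isInternal_homGrading hA hN i)
    (fun p j φ hφ => smul_mem_homDeg hN (hA.mem p) hφ) ?_
  intro φ hφ j
  have := comp_map_zero (F.isInternal_homGrading hA hN i) (F.isInternal_homGrading hA hN (i + 1))
    (F.codiff N i) (fun j φ hφ => F.comp_diff_mem hA i j φ hφ) j φ
  have h0 : F.codiff N i φ = 0 := hφ
  rw [h0, map_zero] at this
  exact this.symm

end FreeResolution

/-! ### Comparison of presentations -/

section Comparison

/-- T induces an injection Z/B → Z'/B'. The comparison of dimensions is written without subtraction.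
-/
theorem finrank_add_le_of_map {k : Type*} [Field k] {V W : Type*} [AddCommGroup V] [Module k V]
    [AddCommGroup W] [Module k W] (T : V →ₗ[k] W) {Z B : Submodule k V} {Z' B' : Submodule k W}
    [Module.Finite k Z] [Module.Finite k Z'] (hBZ : B ≤ Z) (hBZ' : B' ≤ Z')
    (hZ : ∀ z ∈ Z, T z ∈ Z') (hB : ∀ z ∈ B, T z ∈ B') (hinj : ∀ z ∈ Z, T z ∈ B' → z ∈ B) :
    Module.finrank k Z + Module.finrank k B' ≤ Module.finrank k Z' + Module.finrank k B := by
  have := finite_of_le hBZ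
  have := finite_of_le hBZ'
  have h1 := Submodule.finrank_sup_add_finrank_inf_eq (Z.map T) B'
  have h2 : Z.map T ⊓ B' = B.map T := by
    apply le_antisymm
    · rintro _ ⟨⟨z, hz, rfl⟩, hz'⟩
      exact ⟨z, hinj z hz hz', rfl⟩
    · rintro _ ⟨z, hz, rfl⟩
      exact ⟨⟨z, hBZ hz, rfl⟩, hB z hz⟩
  have h3 : Z ⊓ LinearMap.ker T = B ⊓ LinearMap.ker T := by
    apply le_antisymm
    · rintro z ⟨hz, hz'⟩
      exact ⟨hinj z hz (by rw [show T z = 0 from hz']; exact zero_mem _), hz'⟩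
    · exact inf_le_inf_right _ hBZ
  have h4 : Module.finrank k (Z.map T ⊔ B' : Submodule k W) ≤ Module.finrank k Z' :=
    Submodule.finrank_mono (sup_le (by rintro _ ⟨z, hz, rfl⟩; exact hZ z hz) hBZ')
  have h5 := finrank_map_add_inf_ker T Z
  have h6 := finrank_map_add_inf_ker T B
  rw [h2] at h1
  rw [h3] at h5
  omega

variable {k : Type v} [Field k] {A : Type u} [CommRing A] [Algebra k A]

/-- Homogeneous maps of degree `0`. -/
def IsGradedMap {V W : Type*} [AddCommGroup V] [Module k V] [Module A V]
    [AddCommGroup W] [Module k W] [Module A W] (𝒱 : ℤ → Submodule k V) (𝒲 : ℤ → Submodule k W)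
    (g : V →ₗ[A] W) : Prop := ∀ l, ∀ v ∈ 𝒱 l, g v ∈ 𝒲 l

/-- The lifting property of graded projective modules. -/
def IsGradedProjective (𝒜 : ℤ → Submodule k A) {P : Type u} [AddCommGroup P] [Module k P]
    [Module A P] (𝒳 : ℤ → Submodule k P) : Prop :=
  ∀ (W Z : Type u) [AddCommGroup W] [Module k W] [Module A W] [IsScalarTower k A W]
    [AddCommGroup Z] [Module k Z] [Module A Z] [IsScalarTower k A Z] (𝒲 : ℤ → Submodule k W)
    (𝒵 : ℤ → Submodule k Z), IsGradedModule 𝒜 𝒲 → DirectSum.IsInternal 𝒵 →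
    ∀ (g : W →ₗ[A] Z) (h : P →ₗ[A] Z), IsGradedMap 𝒲 𝒵 g → IsGradedMap 𝒳 𝒵 h →
      (∀ v, h v ∈ LinearMap.range g) → ∃ h' : P →ₗ[A] W, IsGradedMap 𝒳 𝒲 h' ∧ g ∘ₗ h' = h

variable {𝒜 : ℤ → Submodule k A} {ι : Type*} {x : ι → A} {w : ι → ℤ}

/-- Any preimage of the image of the p-th basis vector may be replaced by its component of degree a
p, since g commutes with taking components. -/
theorem isGradedProjective_freeGrading (hA : IsPosGraded 𝒜 x w) {r : ℕ} (a : Fin r → ℤ) :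
    IsGradedProjective 𝒜 (freeGrading 𝒜 a) := by
  intro W Z _ _ _ _ _ _ _ _ 𝒲 𝒵 hW hZ g h hg hh hgh
  choose y hy using fun p => hgh (Pi.single p 1)
  have hy' : ∀ p, g (comp hW.isInternal (a p) (y p)) = h (Pi.single p 1) := by
    intro p
    have h1 := comp_map_zero hW.isInternal hZ (g.restrictScalars k) hg (a p) (y p)
    rw [LinearMap.restrictScalars_apply, LinearMap.restrictScalars_apply, hy] at h1
    rw [← h1, comp_same hZ (hh _ _ (single_mem_freeGrading hA a p))]
  have hc : ∀ (z : Fin r → W) p,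
      (Pi.basisFun A (Fin r)).constr A z (Pi.single p 1) = z p := fun z p => by
    rw [← Pi.basisFun_apply, Module.Basis.constr_basis]
  refine ⟨(Pi.basisFun A (Fin r)).constr A fun p => comp hW.isInternal (a p) (y p), ?_, ?_⟩
  · intro l v hv
    have := map_mem_of_single hW.smul_mem (d := 0)
      (g := (Pi.basisFun A (Fin r)).constr A fun p => comp hW.isInternal (a p) (y p))
      (fun p => by rw [hc, add_zero]; exact comp_mem _ _ _) hv
    rwa [add_zero] at this
  · refine (Pi.basisFun A (Fin r)).ext fun p => ?_
    rw [Pi.basisFun_apply, LinearMap.comp_apply, hc, hy']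

theorem isGradedProjective_prod_shift {P P' : Type u} [AddCommGroup P] [Module k P] [Module A P]
    [AddCommGroup P'] [Module k P'] [Module A P'] {𝒳 : ℤ → Submodule k P}
    {𝒳' : ℤ → Submodule k P'} (hP : IsGradedProjective 𝒜 𝒳)
    {e : ℤ} (hP' : IsGradedProjective 𝒜 fun j => 𝒳' (j - e)) :
    IsGradedProjective 𝒜 fun j => (𝒳 j).prod (𝒳' (j - e)) := by
  intro W Z _ _ _ _ _ _ _ _ 𝒲 𝒵 hW hZ g h hg hh hgh
  obtain ⟨h1, h1g, h1'⟩ := hP W Z 𝒲 𝒵 hW hZ g (h ∘ₗ LinearMap.inl A P P') hg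
    (fun l v hv => hh l _ ⟨hv, zero_mem _⟩) fun v => hgh _
  obtain ⟨h2, h2g, h2'⟩ := hP' W Z 𝒲 𝒵 hW hZ g (h ∘ₗ LinearMap.inr A P P') hg
    (fun l v hv => hh l _ ⟨zero_mem _, hv⟩) fun v => hgh _
  refine ⟨h1.coprod h2, fun l v hv => ?_, ?_⟩
  · exact add_mem (h1g l _ hv.1) (h2g l _ hv.2)
  · rw [LinearMap.comp_coprod, h1', h2']
    ext v <;> simp

/-- A graded projective presentation `P₂ → P₁ → P₀ → K → 0` of a graded module. -/
structure IsGradedPresentation (𝒜 : ℤ → Submodule k A) {P₀ P₁ P₂ K : Type u} [AddCommGroup P₀]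
    [Module k P₀] [Module A P₀] [AddCommGroup P₁] [Module k P₁] [Module A P₁] [AddCommGroup P₂]
    [Module A P₂] [AddCommGroup K] [Module k K] [Module A K] (𝒳₀ : ℤ → Submodule k P₀)
    (𝒳₁ : ℤ → Submodule k P₁) (𝒦 : ℤ → Submodule k K) (p₂ : P₂ →ₗ[A] P₁) (p₁ : P₁ →ₗ[A] P₀)
    (ε : P₀ →ₗ[A] K) : Prop where
  graded₀ : IsGradedModule 𝒜 𝒳₀
  graded₁ : IsGradedModule 𝒜 𝒳₁
  proj₀ : IsGradedProjective 𝒜 𝒳₀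
  proj₁ : IsGradedProjective 𝒜 𝒳₁
  map₁ : IsGradedMap 𝒳₁ 𝒳₀ p₁
  map₀ : IsGradedMap 𝒳₀ 𝒦 ε
  surjective : Function.Surjective ε
  exact₀ : Function.Exact p₁ ε
  exact₁ : Function.Exact p₂ p₁

variable {P₀ P₁ P₂ Q₀ Q₁ Q₂ K : Type u} [AddCommGroup P₀] [Module k P₀] [Module A P₀]
  [IsScalarTower k A P₀] [AddCommGroup P₁] [Module k P₁] [Module A P₁] [IsScalarTower k A P₁]
  [AddCommGroup P₂] [Module A P₂]
  [AddCommGroup Q₀] [Module k Q₀] [Module A Q₀] [IsScalarTower k A Q₀] [AddCommGroup Q₁]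
  [Module k Q₁] [Module A Q₁] [IsScalarTower k A Q₁] [AddCommGroup Q₂] [Module A Q₂]
  [AddCommGroup K] [Module k K] [Module A K] [IsScalarTower k A K]
  {𝒳₀ : ℤ → Submodule k P₀} {𝒳₁ : ℤ → Submodule k P₁} {𝒴₀ : ℤ → Submodule k Q₀}
  {𝒴₁ : ℤ → Submodule k Q₁} {𝒦 : ℤ → Submodule k K}
  {p₂ : P₂ →ₗ[A] P₁} {p₁ : P₁ →ₗ[A] P₀} {ε : P₀ →ₗ[A] K}
  {q₂ : Q₂ →ₗ[A] Q₁} {q₁ : Q₁ →ₗ[A] Q₀} {ε' : Q₀ →ₗ[A] K}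
  {N : Type*} [AddCommGroup N] [Module k N] [Module A N] [IsScalarTower k A N]
  {𝒩 : ℤ → Submodule k N}

theorem IsGradedPresentation.exists_chainMap (hP : IsGradedPresentation 𝒜 𝒳₀ 𝒳₁ 𝒦 p₂ p₁ ε)
    (hQ : IsGradedPresentation 𝒜 𝒴₀ 𝒴₁ 𝒦 q₂ q₁ ε') (hK : DirectSum.IsInternal 𝒦) :
    ∃ (β₀ : P₀ →ₗ[A] Q₀) (β₁ : P₁ →ₗ[A] Q₁), IsGradedMap 𝒳₀ 𝒴₀ β₀ ∧ IsGradedMap 𝒳₁ 𝒴₁ β₁ ∧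
      ε' ∘ₗ β₀ = ε ∧ q₁ ∘ₗ β₁ = β₀ ∘ₗ p₁ := by
  obtain ⟨β₀, h0, h0'⟩ := hP.proj₀ Q₀ K 𝒴₀ 𝒦 hQ.graded₀ hK ε' ε hQ.map₀ hP.map₀
    fun v => hQ.surjective _
  obtain ⟨β₁, h1, h1'⟩ := hP.proj₁ Q₁ Q₀ 𝒴₁ 𝒴₀ hQ.graded₁ hQ.graded₀.isInternal q₁ (β₀ ∘ₗ p₁)
    hQ.map₁ (fun l v hv => h0 _ _ (hP.map₁ l v hv)) fun v => by
      refine (hQ.exact₀ _).1 ?_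
      rw [← LinearMap.comp_apply, ← LinearMap.comp_assoc, h0']
      exact hP.exact₀.apply_apply_eq_zero v
  exact ⟨β₀, β₁, h0, h1, h0', h1'⟩

/-- Comparison of the cohomology in degrees `0` and `1` of the complexes of homomorphisms from two
presentations of the same module. -/
theorem IsGradedPresentation.finrank_le (hP : IsGradedPresentation 𝒜 𝒳₀ 𝒳₁ 𝒦 p₂ p₁ ε)
    (hQ : IsGradedPresentation 𝒜 𝒴₀ 𝒴₁ 𝒦 q₂ q₁ ε') (hK : DirectSum.IsInternal 𝒦)
    (hPf₀ : ∀ j, Module.Finite k (homDeg A 𝒳₀ 𝒩 j)) (hPf₁ : ∀ j, Module.Finite k (homDeg A 𝒳₁ 𝒩 j))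
    (hQf₀ : ∀ j, Module.Finite k (homDeg A 𝒴₀ 𝒩 j)) (hQf₁ : ∀ j, Module.Finite k (homDeg A 𝒴₁ 𝒩 j))
    (j : ℤ) :
    hilbertFun (part (homDeg A 𝒴₀ 𝒩) (LinearMap.ker (LinearMap.lcomp A N q₁))) j ≤
      hilbertFun (part (homDeg A 𝒳₀ 𝒩) (LinearMap.ker (LinearMap.lcomp A N p₁))) j ∧
    hilbertFun (part (homDeg A 𝒴₁ 𝒩) (LinearMap.ker (LinearMap.lcomp A N q₂))) j +
        hilbertFun (part (homDeg A 𝒳₁ 𝒩) (LinearMap.range (LinearMap.lcomp A N p₁))) j ≤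
      hilbertFun (part (homDeg A 𝒳₁ 𝒩) (LinearMap.ker (LinearMap.lcomp A N p₂))) j +
        hilbertFun (part (homDeg A 𝒴₁ 𝒩) (LinearMap.range (LinearMap.lcomp A N q₁))) j := by
  obtain ⟨β₀, β₁, hβ₀, hβ₁, hβε, hβ⟩ := hP.exists_chainMap hQ hK
  obtain ⟨α₀, α₁, hα₀, hα₁, hαε, hα⟩ := hQ.exists_chainMap hP hK
  -- The first component of a homotopy from the identity to β ∘ α. No further component is needed,
  -- which is why two terms and exactness at the second suffice.
  obtain ⟨s, -, hs⟩ := hQ.proj₀ Q₁ Q₀ 𝒴₁ 𝒴₀ hQ.graded₁ hQ.graded₀.isInternal q₁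
    (β₀ ∘ₗ α₀ - LinearMap.id) hQ.map₁
    (fun l v hv => sub_mem (hβ₀ _ _ (hα₀ _ _ hv)) hv) fun v => by
      refine (hQ.exact₀ _).1 ?_
      have h1 := LinearMap.congr_fun hβε (α₀ v)
      have h2 := LinearMap.congr_fun hαε v
      simp only [LinearMap.comp_apply] at h1 h2
      simp [h1, h2]
  have hsv : ∀ v, q₁ (s v) = β₀ (α₀ v) - v := fun v => LinearMap.congr_fun hs v
  have hβv : ∀ v, q₁ (β₁ v) = β₀ (p₁ v) := fun v => LinearMap.congr_fun hβ v
  have hαv : ∀ v, p₁ (α₁ v) = α₀ (q₁ v) := fun v => LinearMap.congr_fun hα v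
  have hq2 : ∀ φ : Q₁ →ₗ[A] N, φ ∘ₗ q₂ = 0 → ∀ v, q₁ v = 0 → φ v = 0 := by
    intro φ hφ v hv
    obtain ⟨v', rfl⟩ := (hQ.exact₁ v).1 hv
    exact LinearMap.congr_fun hφ v'
  have hfin : ∀ {V : Type _} [AddCommGroup V] [Module k V] [Module A V] [IsScalarTower k A V]
      {𝒱 : ℤ → Submodule k V} (U : Submodule A V), (∀ j, Module.Finite k (𝒱 j)) →
      Module.Finite k (part 𝒱 U j) := fun U h => have := h j; finite_of_le inf_le_left
  constructor
  · have := hfin (LinearMap.ker (LinearMap.lcomp A N q₁)) hQf₀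
    have := hfin (LinearMap.ker (LinearMap.lcomp A N p₁)) hPf₀
    have h := finrank_add_le_of_map ((LinearMap.lcomp A N β₀).restrictScalars k)
      (Z := part (homDeg A 𝒴₀ 𝒩) (LinearMap.ker (LinearMap.lcomp A N q₁)) j)
      (Z' := part (homDeg A 𝒳₀ 𝒩) (LinearMap.ker (LinearMap.lcomp A N p₁)) j)
      bot_le bot_le ?_ ?_ ?_
    · rw [finrank_bot, finrank_bot, add_zero, add_zero] at h
      unfold hilbertFun
      exact_mod_cast h
    · rintro φ ⟨hφ, hφ'⟩
      refine ⟨fun l v hv => hφ l _ (hβ₀ l v hv), ?_⟩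
      have hφ'' : φ ∘ₗ q₁ = 0 := hφ'
      refine LinearMap.ext fun v => ?_
      change φ (β₀ (p₁ v)) = 0
      rw [← hβv]
      exact LinearMap.congr_fun hφ'' _
    · intro z hz
      rw [(Submodule.mem_bot k).1 hz, map_zero]
      exact zero_mem _
    · rintro φ ⟨-, hφ'⟩ hφ0
      have hφ'' : φ ∘ₗ q₁ = 0 := hφ'
      have hφ1 : φ ∘ₗ β₀ = 0 := (Submodule.mem_bot k).1 hφ0
      refine (Submodule.mem_bot k).2 (LinearMap.ext fun v => ?_)
      have h1 : v = β₀ (α₀ v) - q₁ (s v) := by rw [hsv]; abel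
      have h2 := LinearMap.congr_fun hφ1 (α₀ v)
      have h3 := LinearMap.congr_fun hφ'' (s v)
      simp only [LinearMap.comp_apply, LinearMap.zero_apply] at h2 h3
      rw [h1, map_sub, h2, h3, sub_zero, LinearMap.zero_apply]
  · have := hfin (LinearMap.ker (LinearMap.lcomp A N q₂)) hQf₁
    have := hfin (LinearMap.ker (LinearMap.lcomp A N p₂)) hPf₁
    have h := finrank_add_le_of_map ((LinearMap.lcomp A N β₁).restrictScalars k)
      (Z := part (homDeg A 𝒴₁ 𝒩) (LinearMap.ker (LinearMap.lcomp A N q₂)) j)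
      (Z' := part (homDeg A 𝒳₁ 𝒩) (LinearMap.ker (LinearMap.lcomp A N p₂)) j)
      (B := part (homDeg A 𝒴₁ 𝒩) (LinearMap.range (LinearMap.lcomp A N q₁)) j)
      (B' := part (homDeg A 𝒳₁ 𝒩) (LinearMap.range (LinearMap.lcomp A N p₁)) j)
      ?_ ?_ ?_ ?_ ?_
    · unfold hilbertFun
      exact_mod_cast h
    · rintro _ ⟨h, ψ, rfl⟩
      refine ⟨h, LinearMap.ext fun v => ?_⟩
      simp [hQ.exact₁.apply_apply_eq_zero]
    · rintro _ ⟨h, ψ, rfl⟩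
      refine ⟨h, LinearMap.ext fun v => ?_⟩
      simp [hP.exact₁.apply_apply_eq_zero]
    · rintro φ ⟨hφ, hφ'⟩
      refine ⟨fun l v hv => hφ l _ (hβ₁ l v hv), LinearMap.ext fun v => ?_⟩
      refine hq2 φ hφ' (β₁ (p₂ v)) ?_
      rw [hβv, hP.exact₁.apply_apply_eq_zero, map_zero]
    · rintro _ ⟨hφ, ψ, rfl⟩
      refine ⟨fun l v hv => hφ l _ (hβ₁ l v hv), ψ ∘ₗ β₀, LinearMap.ext fun v => ?_⟩
      simp [hβv]
    · rintro φ ⟨hφ, hφ'⟩ ⟨-, ψ, hψ⟩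
      -- On Q₁ the map β₁α₁ - 1 - s q₁ lands in ker q₁ = im q₂, where the cocycle φ vanishes. Hence
      -- φ = φβ₁α₁ - φ s q₁, and φβ₁ = ψ p₁ turns this into (ψα₀ - φ s) q₁.
      refine ⟨hφ, ψ ∘ₗ α₀ - φ ∘ₗ s, LinearMap.ext fun v => ?_⟩
      have hψv : ∀ v, ψ (p₁ v) = φ (β₁ v) := fun v => LinearMap.congr_fun hψ v
      have h1 : φ (β₁ (α₁ v) - v - s (q₁ v)) = 0 := by
        refine hq2 φ hφ' _ ?_
        rw [map_sub, map_sub, hβv, hαv, hsv]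
        abel
      rw [map_sub, map_sub, ← hψv, hαv, sub_sub, add_comm, ← sub_sub, sub_eq_zero] at h1
      simpa using h1

end Comparison

namespace FreeResolution

/-! ### The cone of a chain map of degree `-2` -/

variable {k : Type v} [Field k] {A : Type u} [CommRing A] [Algebra k A] {𝒜 : ℤ → Submodule k A}
  {ι : Type*} {x : ι → A} {w : ι → ℤ}
  {M : Type*} [AddCommGroup M] [Module k M] [Module A M]
  {ℳ : ℤ → Submodule k M}
  {N : Type*} [AddCommGroup N] [Module k N] [Module A N] [IsScalarTower k A N]
  {𝒩 : ℤ → Submodule k N} (F : FreeResolution 𝒜 ℳ)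

/-- The grading of `F_{m+1} ⊕ F_m(-e)`. -/
def coneGrading (m : ℕ) (e j : ℤ) : Submodule k (F.Obj (m + 1) × F.Obj m) :=
  (freeGrading 𝒜 (F.deg (m + 1)) j).prod (freeGrading 𝒜 (F.deg m) (j - e))

/-- The differential of the cone of `τ`. -/
def coneDiff (m : ℕ) (τ : F.Obj (m + 2) →ₗ[A] F.Obj m) :
    (F.Obj (m + 2) × F.Obj (m + 1)) →ₗ[A] (F.Obj (m + 1) × F.Obj m) :=
  (F.diff (m + 1) ∘ₗ LinearMap.fst A _ _).prod
    (F.diff m ∘ₗ LinearMap.snd A _ _ - τ ∘ₗ LinearMap.fst A _ _)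

/-- The projection of the cone onto the pushout. -/
def coneAug (m : ℕ) (τ : F.Obj (m + 2) →ₗ[A] F.Obj m) :
    (F.Obj (m + 1) × F.Obj m) →ₗ[A] F.Pushout m τ :=
  (F.pushoutRelations m τ).mkQ ∘ₗ
    LinearMap.prodMap LinearMap.id (LinearMap.range (F.diff m)).mkQ

@[simp]
theorem coneDiff_apply (m : ℕ) (τ : F.Obj (m + 2) →ₗ[A] F.Obj m) (v : F.Obj (m + 2))
    (v' : F.Obj (m + 1)) :
    F.coneDiff m τ (v, v') = (F.diff (m + 1) v, F.diff m v' - τ v) := rfl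

theorem isGradedModule_coneGrading (hA : IsPosGraded 𝒜 x w) (m : ℕ) (e : ℤ) :
    IsGradedModule 𝒜 (F.coneGrading m e) where
  isInternal := isInternal_prod_shift (isGradedModule_freeGrading hA _).isInternal
    (isGradedModule_freeGrading hA _).isInternal e
  smul_mem {i j b v} hb hv := by
    refine ⟨(isGradedModule_freeGrading hA _).smul_mem hb hv.1, ?_⟩
    have := (isGradedModule_freeGrading hA _).smul_mem hb hv.2
    rwa [← add_sub_assoc] at this

/-- A shift of a graded free module is again graded free, with basis degrees raised by e; so the
second summand of the cone has the lifting property. -/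
theorem freeGrading_shift {r : ℕ} (a : Fin r → ℤ) (e : ℤ) :
    (fun j => freeGrading 𝒜 a (j - e)) = freeGrading 𝒜 fun p => a p + e := by
  funext j
  ext v
  rw [mem_freeGrading, mem_freeGrading]
  simp only [sub_sub, add_comm e]

theorem isGradedProjective_coneGrading (hA : IsPosGraded 𝒜 x w) (m : ℕ) (e : ℤ) :
    IsGradedProjective 𝒜 (F.coneGrading m e) := by
  refine isGradedProjective_prod_shift (isGradedProjective_freeGrading hA _) ?_
  rw [freeGrading_shift]
  exact isGradedProjective_freeGrading hA _

variable {e : ℤ}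

theorem isGradedMap_coneDiff (hA : IsPosGraded 𝒜 x w) (m : ℕ) {τ : F.Obj (m + 2) →ₗ[A] F.Obj m}
    (hτ : ∀ l, ∀ v ∈ freeGrading 𝒜 (F.deg (m + 2)) l, τ v ∈ freeGrading 𝒜 (F.deg m) (l - e)) :
    IsGradedMap (F.coneGrading (m + 1) e) (F.coneGrading m e) (F.coneDiff m τ) := by
  rintro l ⟨v, v'⟩ ⟨hv, hv'⟩
  exact ⟨F.diff_mem hA _ _ _ hv, sub_mem (F.diff_mem hA _ _ _ hv') (hτ _ _ hv)⟩

theorem map_coneAug (m : ℕ) (τ : F.Obj (m + 2) →ₗ[A] F.Obj m) (j : ℤ) :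
    F.pushoutGrading m τ e j =
      (F.coneGrading m e j).map ((F.coneAug m τ).restrictScalars k) := by
  apply le_antisymm
  · rintro _ ⟨⟨v, _⟩, ⟨hv, v', hv', rfl⟩, rfl⟩
    exact ⟨(v, v'), ⟨hv, hv'⟩, rfl⟩
  · rintro _ ⟨⟨v, v'⟩, ⟨hv, hv'⟩, rfl⟩
    exact ⟨(v, (LinearMap.range (F.diff m)).mkQ v'), ⟨hv, v', hv', rfl⟩, rfl⟩

theorem coneAug_surjective (m : ℕ) (τ : F.Obj (m + 2) →ₗ[A] F.Obj m) :
    Function.Surjective (F.coneAug m τ) :=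
  (Submodule.mkQ_surjective _).comp
    (Function.Surjective.prodMap Function.surjective_id (Submodule.mkQ_surjective _))

theorem exact_coneDiff_coneAug (m : ℕ) (τ : F.Obj (m + 2) →ₗ[A] F.Obj m) :
    Function.Exact (F.coneDiff m τ) (F.coneAug m τ) := by
  rintro ⟨v, v'⟩
  have h1 : F.coneAug m τ (v, v') = 0 ↔
      (v, (LinearMap.range (F.diff m)).mkQ v') ∈ F.pushoutRelations m τ :=
    Submodule.Quotient.mk_eq_zero _
  rw [h1]
  constructor
  · rintro ⟨u, hu⟩
    have h2 : F.diff (m + 1) u = v := congrArg Prod.fst hu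
    have h3 : -(LinearMap.range (F.diff m)).mkQ (τ u) = (LinearMap.range (F.diff m)).mkQ v' :=
      congrArg Prod.snd hu
    rw [← map_neg, ← sub_eq_zero, ← map_sub] at h3
    obtain ⟨u', hu'⟩ := (Submodule.Quotient.mk_eq_zero _).1 h3
    refine ⟨(u, -u'), ?_⟩
    rw [coneDiff_apply, h2, map_neg, hu']
    congr 1
    abel
  · rintro ⟨⟨u, u'⟩, hu⟩
    rw [coneDiff_apply, Prod.mk.injEq] at hu
    refine ⟨u, Prod.ext hu.1 ?_⟩
    change -(LinearMap.range (F.diff m)).mkQ (τ u) = (LinearMap.range (F.diff m)).mkQ v'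
    rw [← map_neg, ← sub_eq_zero, ← map_sub]
    refine (Submodule.Quotient.mk_eq_zero _).2 ⟨-u', ?_⟩
    rw [← hu.2, map_neg]
    abel

/-- The sign of τ alternates because ∂ keeps its sign on both summands: the composite has second
coordinate ∂τ' - τ∂. Exactness is a lift through F in the first coordinate, then in the second. -/
theorem exact_coneDiff (m : ℕ) {τ : F.Obj (m + 2) →ₗ[A] F.Obj m}
    {τ' : F.Obj (m + 3) →ₗ[A] F.Obj (m + 1)} (hττ' : F.diff m ∘ₗ τ' = τ ∘ₗ F.diff (m + 2)) :
    Function.Exact (F.coneDiff (m + 1) (-τ')) (F.coneDiff m τ) := by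
  have hτv : ∀ v, F.diff m (τ' v) = τ (F.diff (m + 2) v) := fun v => LinearMap.congr_fun hττ' v
  rintro ⟨v, v'⟩
  rw [coneDiff_apply, Prod.mk_eq_zero]
  constructor
  · rintro ⟨h1, h2⟩
    obtain ⟨u, rfl⟩ := F.exists_of_diff_eq_zero h1
    rw [← hτv, ← map_sub] at h2
    obtain ⟨u', hu'⟩ := F.exists_of_diff_eq_zero h2
    refine ⟨(u, u'), ?_⟩
    rw [coneDiff_apply, hu']
    simp
  · rintro ⟨⟨u, u'⟩, hu⟩
    rw [coneDiff_apply, Prod.mk.injEq] at hu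
    rw [← hu.1, ← hu.2]
    simp [F.diff_diff, hτv]

theorem isInternal_pushoutGrading (hA : IsPosGraded 𝒜 x w) (m : ℕ)
    {τ : F.Obj (m + 2) →ₗ[A] F.Obj m}
    (hτ : ∀ l, ∀ v ∈ freeGrading 𝒜 (F.deg (m + 2)) l, τ v ∈ freeGrading 𝒜 (F.deg m) (l - e)) :
    DirectSum.IsInternal (F.pushoutGrading m τ e) := by
  rw [funext (F.map_coneAug m τ)]
  refine isInternal_map (F.isGradedModule_coneGrading hA m e).isInternal
    ((F.coneAug m τ).restrictScalars k) (F.coneAug_surjective m τ) ?_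
  intro v hv j
  obtain ⟨u, rfl⟩ := (F.exact_coneDiff_coneAug m τ v).1 hv
  have := comp_map_zero (F.isGradedModule_coneGrading hA (m + 1) e).isInternal
    (F.isGradedModule_coneGrading hA m e).isInternal ((F.coneDiff m τ).restrictScalars k)
    (F.isGradedMap_coneDiff hA m hτ) j u
  rw [LinearMap.restrictScalars_apply] at this
  rw [this]
  exact (F.exact_coneDiff_coneAug m τ).apply_apply_eq_zero _

theorem isGradedPresentation_cone (hA : IsPosGraded 𝒜 x w) (m : ℕ)
    {τ : F.Obj (m + 2) →ₗ[A] F.Obj m}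
    (hτ : ∀ l, ∀ v ∈ freeGrading 𝒜 (F.deg (m + 2)) l, τ v ∈ freeGrading 𝒜 (F.deg m) (l - e))
    {τ' : F.Obj (m + 3) →ₗ[A] F.Obj (m + 1)} (hττ' : F.diff m ∘ₗ τ' = τ ∘ₗ F.diff (m + 2)) :
    IsGradedPresentation 𝒜 (F.coneGrading m e) (F.coneGrading (m + 1) e) (F.pushoutGrading m τ e)
      (F.coneDiff (m + 1) (-τ')) (F.coneDiff m τ) (F.coneAug m τ) where
  graded₀ := F.isGradedModule_coneGrading hA m e
  graded₁ := F.isGradedModule_coneGrading hA (m + 1) e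
  proj₀ := F.isGradedProjective_coneGrading hA m e
  proj₁ := F.isGradedProjective_coneGrading hA (m + 1) e
  map₁ := F.isGradedMap_coneDiff hA m hτ
  map₀ l v hv := by
    rw [map_coneAug]
    exact ⟨v, hv, rfl⟩
  surjective := F.coneAug_surjective m τ
  exact₀ := F.exact_coneDiff_coneAug m τ
  exact₁ := F.exact_coneDiff m hττ'

theorem isGradedPresentation {K : Type u} [AddCommGroup K] [Module k K] [Module A K]
    {𝒦 : ℤ → Submodule k K} (G : FreeResolution 𝒜 𝒦) (hA : IsPosGraded 𝒜 x w)
    (hK : IsGradedModule 𝒜 𝒦) :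
    IsGradedPresentation 𝒜 (freeGrading 𝒜 (G.deg 0)) (freeGrading 𝒜 (G.deg 1)) 𝒦
      (G.diff 1) (G.diff 0) G.aug where
  graded₀ := isGradedModule_freeGrading hA _
  graded₁ := isGradedModule_freeGrading hA _
  proj₀ := isGradedProjective_freeGrading hA _
  proj₁ := isGradedProjective_freeGrading hA _
  map₁ := G.diff_mem hA 0
  map₀ := G.aug_mem' hK
  surjective := G.aug_surjective
  exact₀ := G.exact_aug
  exact₁ := G.exact 0

theorem isGradedModule_pushoutGrading (hA : IsPosGraded 𝒜 x w) (m : ℕ)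
    {τ : F.Obj (m + 2) →ₗ[A] F.Obj m}
    (hτ : ∀ l, ∀ v ∈ freeGrading 𝒜 (F.deg (m + 2)) l, τ v ∈ freeGrading 𝒜 (F.deg m) (l - e)) :
    IsGradedModule 𝒜 (F.pushoutGrading m τ e) where
  isInternal := F.isInternal_pushoutGrading hA m hτ
  smul_mem {i j b v} hb hv := by
    rw [map_coneAug] at hv ⊢
    obtain ⟨v, hv, rfl⟩ := hv
    exact ⟨b • v, (F.isGradedModule_coneGrading hA m e).smul_mem hb hv,
      map_smul (F.coneAug m τ) b v⟩

theorem finite_coneGrading (hfin : ∀ j, Module.Finite k (𝒜 j)) (m : ℕ) (j : ℤ) :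
    Module.Finite k (F.coneGrading m e j) :=
  have := F.finite_freeGrading hfin (m + 1) j
  have := F.finite_freeGrading hfin m (j - e)
  finite_prod _ _

theorem finite_pushoutGrading (hfin : ∀ j, Module.Finite k (𝒜 j)) (m : ℕ)
    (τ : F.Obj (m + 2) →ₗ[A] F.Obj m) (j : ℤ) :
    Module.Finite k (F.pushoutGrading m τ e j) := by
  rw [map_coneAug]
  have := F.finite_coneGrading (e := e) hfin m j
  infer_instance

/-- The Hilbert function of the pushout. -/
theorem hilbertFun_pushoutGrading (hA : IsPosGraded 𝒜 x w) (hfin : ∀ j, Module.Finite k (𝒜 j))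
    (m : ℕ) {τ : F.Obj (m + 2) →ₗ[A] F.Obj m}
    (hτ : ∀ l, ∀ v ∈ freeGrading 𝒜 (F.deg (m + 2)) l, τ v ∈ freeGrading 𝒜 (F.deg m) (l - e))
    {τ' : F.Obj (m + 3) →ₗ[A] F.Obj (m + 1)} (hττ' : F.diff m ∘ₗ τ' = τ ∘ₗ F.diff (m + 2))
    (j : ℤ) :
    hilbertFun (F.pushoutGrading m τ e) j = hilbertFun (F.bdry m) j +
      (hilbertFun (freeGrading 𝒜 (F.deg m)) (j - e) - hilbertFun (F.bdry m) (j - e)) := by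
  have hτv : ∀ v, F.diff m (τ' v) = τ (F.diff (m + 2) v) := fun v => LinearMap.congr_fun hττ' v
  have := F.finite_coneGrading (e := e) hfin m j
  have := F.finite_freeGrading hfin (m + 1) j
  have := F.finite_freeGrading hfin m (j - e)
  have h1 := finrank_map_add_inf_ker ((F.coneAug m τ).restrictScalars k) (F.coneGrading m e j)
  rw [← map_coneAug] at h1
  have h2 : Module.finrank k (F.coneGrading m e j) = _ := finrank_prod _ _
  set R := F.coneGrading m e j ⊓ LinearMap.ker ((F.coneAug m τ).restrictScalars k)
  have : Module.Finite k R := finite_of_le inf_le_left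
  have h3 := finrank_map_add_inf_ker (LinearMap.fst k (F.Obj (m + 1)) (F.Obj m)) R
  have h4 : R.map (LinearMap.fst k _ _) = F.bdry (m + 1) j := by
    apply le_antisymm
    · rintro _ ⟨⟨v, v'⟩, ⟨hv, hv'⟩, rfl⟩
      obtain ⟨⟨u, u'⟩, hu⟩ := (F.exact_coneDiff_coneAug m τ _).1 hv'
      exact ⟨hv.1, u, congrArg Prod.fst hu⟩
    · rw [← F.map_diff hA]
      rintro _ ⟨u, hu, rfl⟩
      exact ⟨(F.diff (m + 1) u, - τ u), ⟨⟨F.diff_mem hA _ _ _ hu, neg_mem (hτ _ _ hu)⟩,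
        (F.exact_coneDiff_coneAug m τ _).2 ⟨(u, 0), by simp⟩⟩, rfl⟩
  -- This expresses the injectivity of Syz_m(-e) → K. If ∂u = 0 and v' = ∂u' - τu, then u = ∂y and
  -- v' = ∂(u' - τ'y), by the chain map property.
  have h5 : R ⊓ LinearMap.ker (LinearMap.fst k (F.Obj (m + 1)) (F.Obj m)) =
      (F.bdry m (j - e)).map (LinearMap.inr k (F.Obj (m + 1)) (F.Obj m)) := by
    apply le_antisymm
    · rintro ⟨v, v'⟩ ⟨⟨hv, hv'⟩, (rfl : v = 0)⟩
      obtain ⟨⟨u, u'⟩, hu⟩ := (F.exact_coneDiff_coneAug m τ _).1 hv'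
      rw [coneDiff_apply, Prod.mk.injEq] at hu
      obtain ⟨y, rfl⟩ := F.exists_of_diff_eq_zero hu.1
      refine ⟨v', ⟨hv.2, u' - τ' y, ?_⟩, rfl⟩
      rw [map_sub, hτv, hu.2]
    · rintro _ ⟨v', ⟨hv, u', rfl⟩, rfl⟩
      exact ⟨⟨⟨zero_mem _, hv⟩, (F.exact_coneDiff_coneAug m τ _).2 ⟨(0, u'), by simp⟩⟩, rfl⟩
  have : Module.Finite k (F.bdry m (j - e)) := finite_of_le inf_le_left
  have h6 := finrank_map_of_injOn (LinearMap.inr k (F.Obj (m + 1)) (F.Obj m)) (F.bdry m (j - e))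
    fun v _ hv => LinearMap.inr_injective (hv.trans (map_zero _).symm)
  rw [h4, h5, h6] at h3
  have h7 := F.hilbertFun_freeGrading_succ hA hfin m j
  unfold hilbertFun at h7 ⊢
  have h1' := congrArg (Nat.cast (R := ℚ)) h1
  have h2' := congrArg (Nat.cast (R := ℚ)) h2
  have h3' := congrArg (Nat.cast (R := ℚ)) h3
  push_cast at h1' h2' h3'
  linarith

/-! #### Cochains of the cone -/

theorem comp_inl_mem (m : ℕ) (e j : ℤ) {ψ : (F.Obj (m + 1) × F.Obj m) →ₗ[A] N}
    (hψ : ψ ∈ homDeg A (F.coneGrading m e) 𝒩 j) :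
    ψ ∘ₗ LinearMap.inl A _ _ ∈ F.homGrading 𝒩 (m + 1) j :=
  fun l _ hv => hψ l _ ⟨hv, zero_mem _⟩

theorem comp_inr_mem (m : ℕ) (e j : ℤ) {ψ : (F.Obj (m + 1) × F.Obj m) →ₗ[A] N}
    (hψ : ψ ∈ homDeg A (F.coneGrading m e) 𝒩 j) :
    ψ ∘ₗ LinearMap.inr A _ _ ∈ F.homGrading 𝒩 m (j + e) := by
  intro l v hv
  have := hψ (l + e) (0, v) ⟨zero_mem _, by simpa using hv⟩
  rwa [show l + e + j = l + (j + e) by ring] at this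

theorem coprod_mem (m : ℕ) (e j : ℤ) {θ : F.Obj (m + 1) →ₗ[A] N}
    (hθ : θ ∈ F.homGrading 𝒩 (m + 1) j) {φ : F.Obj m →ₗ[A] N}
    (hφ : φ ∈ F.homGrading 𝒩 m (j + e)) :
    θ.coprod φ ∈ homDeg A (F.coneGrading m e) 𝒩 j := by
  rintro l ⟨v, v'⟩ ⟨hv, hv'⟩
  refine add_mem (hθ l v hv) ?_
  have := hφ _ v' hv'
  rwa [show l - e + (j + e) = l + j by ring] at this

theorem isInternal_homDeg_cone (hA : IsPosGraded 𝒜 x w) (hN : IsGradedModule 𝒜 𝒩) (m : ℕ)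
    (e : ℤ) : DirectSum.IsInternal (homDeg A (F.coneGrading m e) 𝒩) := by
  have h : homDeg A (F.coneGrading m e) 𝒩 = fun j =>
      ((F.homGrading 𝒩 (m + 1) j).prod (F.homGrading 𝒩 m (j - -e))).map
        (LinearMap.coprodEquiv k : ((F.Obj (m + 1) →ₗ[A] N) × (F.Obj m →ₗ[A] N)) ≃ₗ[k]
          _).toLinearMap := by
    funext j
    rw [sub_neg_eq_add]
    apply le_antisymm
    · intro ψ hψ
      exact ⟨(ψ ∘ₗ LinearMap.inl A _ _, ψ ∘ₗ LinearMap.inr A _ _),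
        ⟨F.comp_inl_mem m e j hψ, F.comp_inr_mem m e j hψ⟩,
        (LinearMap.coprodEquiv k).apply_symm_apply ψ⟩
    · rintro _ ⟨⟨θ, φ⟩, ⟨hθ, hφ⟩, rfl⟩
      exact F.coprod_mem m e j hθ hφ
  rw [h]
  refine isInternal_map (isInternal_prod_shift (F.isInternal_homGrading hA hN (m + 1))
    (F.isInternal_homGrading hA hN m) (-e)) _ (LinearEquiv.surjective _) ?_
  intro v hv j
  rw [LinearEquiv.coe_coe, LinearEquiv.map_eq_zero_iff] at hv
  rw [hv, map_zero, map_zero]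

/-- Rank–nullity for restriction to the second summand: the image is B and the kernel is Z, the maps
in U that factor through the first summand. The extension in `hB'` must be homogeneous, so that the
count holds in each degree. -/
theorem finrank_part_homDeg_cone (hA : IsPosGraded 𝒜 x w) (hN : IsGradedModule 𝒜 𝒩)
    (hfin : ∀ j, Module.Finite k (𝒩 j)) (m : ℕ) (e j : ℤ)
    (U : Submodule A ((F.Obj (m + 1) × F.Obj m) →ₗ[A] N))
    (Z : Submodule A (F.Obj (m + 1) →ₗ[A] N)) (B : Submodule A (F.Obj m →ₗ[A] N))
    (hZ : ∀ φ, φ ∘ₗ LinearMap.fst A _ _ ∈ U ↔ φ ∈ Z)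
    (hB : ∀ ψ ∈ U, ψ ∘ₗ LinearMap.inr A _ _ ∈ B)
    (hB' : ∀ φ ∈ B, φ ∈ F.homGrading 𝒩 m (j + e) → ∃ θ ∈ F.homGrading 𝒩 (m + 1) j,
      θ.coprod φ ∈ U) :
    Module.Finite k (part (homDeg A (F.coneGrading m e) 𝒩) U j) ∧
    hilbertFun (part (homDeg A (F.coneGrading m e) 𝒩) U) j =
      hilbertFun (part (F.homGrading 𝒩 (m + 1)) Z) j +
        hilbertFun (part (F.homGrading 𝒩 m) B) (j + e) := by
  have := F.finite_homGrading hA hN hfin (m + 1) j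
  have := F.finite_homGrading hA hN hfin m (j + e)
  have hinl := fun ψ hψ => F.comp_inl_mem (𝒩 := 𝒩) m e j (ψ := ψ) hψ
  have hinr := fun ψ hψ => F.comp_inr_mem (𝒩 := 𝒩) m e j (ψ := ψ) hψ
  have hfst : ∀ θ ∈ F.homGrading 𝒩 (m + 1) j,
      θ ∘ₗ LinearMap.fst A _ _ ∈ homDeg A (F.coneGrading m e) 𝒩 j :=
    fun θ hθ l v hv => hθ l _ hv.1
  let R : ((F.Obj (m + 1) × F.Obj m) →ₗ[A] N) →ₗ[k] (F.Obj m →ₗ[A] N) :=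
    (LinearMap.lcomp A N (LinearMap.inr A _ _)).restrictScalars k
  let L : ((F.Obj (m + 1) × F.Obj m) →ₗ[A] N) →ₗ[k] (F.Obj (m + 1) →ₗ[A] N) :=
    (LinearMap.lcomp A N (LinearMap.inl A _ _)).restrictScalars k
  let S : (F.Obj (m + 1) →ₗ[A] N) →ₗ[k] ((F.Obj (m + 1) × F.Obj m) →ₗ[A] N) :=
    (LinearMap.lcomp A N (LinearMap.fst A _ _)).restrictScalars k
  have hfinU : Module.Finite k (part (homDeg A (F.coneGrading m e) 𝒩) U j) := by
    have hp := finite_prod (F.homGrading 𝒩 (m + 1) j) (F.homGrading 𝒩 m (j + e))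
    have := finite_comap (L.prod R) (fun ψ ψ' h => by
      refine LinearMap.prod_ext (congrArg Prod.fst h) (congrArg Prod.snd h))
      ((F.homGrading 𝒩 (m + 1) j).prod (F.homGrading 𝒩 m (j + e)))
    refine finite_of_le (U' := ((F.homGrading 𝒩 (m + 1) j).prod
      (F.homGrading 𝒩 m (j + e))).comap (L.prod R)) fun ψ hψ => ?_
    exact ⟨hinl ψ hψ.1, hinr ψ hψ.1⟩
  refine ⟨hfinU, ?_⟩
  have h1 := finrank_map_add_inf_ker R (part (homDeg A (F.coneGrading m e) 𝒩) U j)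
  have h2 : (part (homDeg A (F.coneGrading m e) 𝒩) U j).map R =
      part (F.homGrading 𝒩 m) B (j + e) := by
    apply le_antisymm
    · rintro _ ⟨ψ, ⟨hψ, hψ'⟩, rfl⟩
      exact ⟨hinr ψ hψ, hB ψ hψ'⟩
    · rintro φ ⟨hφ, hφ'⟩
      obtain ⟨θ, hθ, hθ'⟩ := hB' φ hφ' hφ
      exact ⟨θ.coprod φ, ⟨F.coprod_mem m e j hθ hφ, hθ'⟩, LinearMap.coprod_inr _ _⟩
  have h3 : part (homDeg A (F.coneGrading m e) 𝒩) U j ⊓ LinearMap.ker R =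
      (part (F.homGrading 𝒩 (m + 1)) Z j).map S := by
    apply le_antisymm
    · rintro ψ ⟨⟨hψ, hψ'⟩, h0⟩
      have h0' : ψ ∘ₗ LinearMap.inr A _ _ = 0 := h0
      have hψS : (ψ ∘ₗ LinearMap.inl A _ _) ∘ₗ LinearMap.fst A _ _ = ψ :=
        by
        refine LinearMap.ext fun ⟨v, v'⟩ => ?_
        have h5 : ψ (0, v') = 0 := LinearMap.congr_fun h0' v'
        have h6 : ψ (v, v') = ψ (v, 0) + ψ (0, v') := by rw [← map_add]; simp
        rw [h6, h5, add_zero]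
        rfl
      exact ⟨ψ ∘ₗ LinearMap.inl A _ _, ⟨hinl ψ hψ, (hZ _).1 (by rwa [hψS])⟩, hψS⟩
    · rintro _ ⟨φ, ⟨hφ, hφ'⟩, rfl⟩
      refine ⟨⟨hfst φ hφ, (hZ φ).2 hφ'⟩, ?_⟩
      refine LinearMap.ext fun v => ?_
      exact map_zero φ
  have : Module.Finite k (part (F.homGrading 𝒩 (m + 1)) Z j) := finite_of_le inf_le_left
  have h4 := finrank_map_of_injOn S (part (F.homGrading 𝒩 (m + 1)) Z j) fun φ _ hφ =>
    LinearMap.ext fun v => LinearMap.congr_fun hφ (v, 0)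
  rw [h2, h3, h4] at h1
  unfold hilbertFun
  rw [← h1]
  push_cast
  ring

theorem hilbertFun_homDeg_cone (hA : IsPosGraded 𝒜 x w) (hN : IsGradedModule 𝒜 𝒩)
    (hfin : ∀ j, Module.Finite k (𝒩 j)) (m : ℕ) (e j : ℤ) :
    Module.Finite k (homDeg A (F.coneGrading m e) 𝒩 j) ∧
    hilbertFun (homDeg A (F.coneGrading m e) 𝒩) j =
      hilbertFun (F.homGrading 𝒩 (m + 1)) j + hilbertFun (F.homGrading 𝒩 m) (j + e) := by
  have h := F.finrank_part_homDeg_cone hA hN hfin m e j ⊤ ⊤ ⊤ (fun _ => Iff.rfl)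
    (fun _ _ => trivial) fun _ _ _ => ⟨0, zero_mem _, trivial⟩
  have htop : ∀ {V : Type _} [AddCommGroup V] [Module k V] [Module A V] [IsScalarTower k A V]
      (𝒱 : ℤ → Submodule k V) j, part 𝒱 (⊤ : Submodule A V) j = 𝒱 j := fun 𝒱 j => by
    rw [part, Submodule.restrictScalars_top, inf_top_eq]
  rw [htop] at h
  refine ⟨h.1, ?_⟩
  rw [← hilbertFun_congr (htop _ _), h.2, hilbertFun_congr (htop _ _), hilbertFun_congr (htop _ _)]

/-- The key use of the non-zerodivisor. A cocycle (θ, φ) of the cone satisfies φ∂ = 0 and θ∂ = φτ,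
so φτ is a coboundary and injectivity makes φ one. With φ = 0 there remain the cocycles θ. -/
theorem hilbertFun_ker_coneDiff (hA : IsPosGraded 𝒜 x w) (hN : IsGradedModule 𝒜 𝒩)
    (hfin : ∀ j, Module.Finite k (𝒩 j)) (m : ℕ) {τ : F.Obj (m + 2) →ₗ[A] F.Obj m}
    (hτ : ∀ l, ∀ v ∈ freeGrading 𝒜 (F.deg (m + 2)) l, τ v ∈ freeGrading 𝒜 (F.deg m) (l - e))
    (hinj : ∀ φ ∈ F.cocycles N m, φ ∘ₗ τ ∈ F.coboundaries N (m + 2) ↔ φ ∈ F.coboundaries N m)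
    (j : ℤ) :
    hilbertFun (part (homDeg A (F.coneGrading m e) 𝒩)
        (LinearMap.ker (LinearMap.lcomp A N (F.coneDiff m τ)))) j =
      hilbertFun (F.gradedCocycles 𝒩 (m + 1)) j +
        hilbertFun (F.gradedCoboundaries 𝒩 m) (j + e) := by
  have hker : ∀ ψ, ψ ∈ LinearMap.ker (LinearMap.lcomp A N (F.coneDiff m τ)) ↔
      (∀ v, ψ (F.diff (m + 1) v, 0) = ψ (0, τ v)) ∧ ∀ v, ψ (0, F.diff m v) = 0 := by
    intro ψ
    constructor
    · intro h
      have h1 : ∀ v v', ψ (F.diff (m + 1) v, F.diff m v' - τ v) = 0 := fun v v' =>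
        LinearMap.congr_fun (show ψ ∘ₗ F.coneDiff m τ = 0 from h) (v, v')
      refine ⟨fun v => ?_, fun v => by simpa using h1 0 v⟩
      rw [← sub_eq_zero, ← map_sub]
      simpa using h1 v 0
    · rintro ⟨h1, h2⟩
      refine LinearMap.ext fun ⟨v, v'⟩ => ?_
      change ψ (F.diff (m + 1) v, F.diff m v' - τ v) = 0
      have h3 : ((F.diff (m + 1) v, F.diff m v' - τ v) : F.Obj (m + 1) × F.Obj m) =
        (F.diff (m + 1) v, 0) + (0, F.diff m v') - (0, τ v) := by simp
      rw [h3, map_sub, map_add, h1, h2]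
      simp
  refine (F.finrank_part_homDeg_cone hA hN hfin m e j _ (F.cocycles N (m + 1))
    (F.coboundaries N m) ?_ ?_ ?_).2
  · intro φ
    rw [hker, mem_cocycles]
    constructor
    · rintro ⟨h, -⟩
      refine LinearMap.ext fun v => ?_
      simpa using h v
    · intro h
      refine ⟨fun v => ?_, fun v => by simp⟩
      simpa using LinearMap.congr_fun h v
  · intro ψ hψ
    rw [hker] at hψ
    refine (hinj _ ?_).1 ⟨ψ ∘ₗ LinearMap.inl A _ _, ?_⟩
    · exact LinearMap.ext hψ.2
    · exact LinearMap.ext hψ.1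
  · intro φ hφ hφj
    have hc := F.coboundaries_le_cocycles m hφ
    have h1 : φ ∘ₗ τ ∈ F.gradedCoboundaries 𝒩 (m + 2) j := by
      refine ⟨fun l v hv => ?_, (hinj φ hc).2 hφ⟩
      have := hφj _ _ (hτ l v hv)
      rwa [show l - e + (j + e) = l + j by ring] at this
    -- A homogeneous coboundary is the coboundary of a homogeneous cochain; this gives θ of degree j
    -- with θ∂ = φτ.
    rw [← F.map_codiff hA hN] at h1
    obtain ⟨θ, hθ, hθ'⟩ := h1
    refine ⟨θ, hθ, (hker _).2 ⟨fun v => ?_, fun v => ?_⟩⟩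
    · have h2 : θ (F.diff (m + 1) v) = φ (τ v) := LinearMap.congr_fun hθ' v
      simpa using h2
    · simpa using LinearMap.congr_fun hc v

/-! ### Ext modules of the pushout -/

/-- The Hilbert functions of `Ext^0` and `Ext^1` of the pushout. -/
theorem hilbertFun_extGrading_pushout (hA : IsPosGraded 𝒜 x w) (hN : IsGradedModule 𝒜 𝒩)
    (hfin : ∀ j, Module.Finite k (𝒩 j)) (m : ℕ) {τ : F.Obj (m + 2) →ₗ[A] F.Obj m}
    (hτ : ∀ l, ∀ v ∈ freeGrading 𝒜 (F.deg (m + 2)) l, τ v ∈ freeGrading 𝒜 (F.deg m) (l - e))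
    (hinj : ∀ φ ∈ F.cocycles N m, φ ∘ₗ τ ∈ F.coboundaries N (m + 2) ↔ φ ∈ F.coboundaries N m)
    {τ' : F.Obj (m + 3) →ₗ[A] F.Obj (m + 1)}
    (hτ' : ∀ l, ∀ v ∈ freeGrading 𝒜 (F.deg (m + 3)) l,
      τ' v ∈ freeGrading 𝒜 (F.deg (m + 1)) (l - e))
    (hinj' : ∀ φ ∈ F.cocycles N (m + 1),
      φ ∘ₗ τ' ∈ F.coboundaries N (m + 3) ↔ φ ∈ F.coboundaries N (m + 1))
    (hττ' : F.diff m ∘ₗ τ' = τ ∘ₗ F.diff (m + 2))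
    (G : FreeResolution 𝒜 (F.pushoutGrading m τ e)) (j : ℤ) :
    hilbertFun (G.extGrading 𝒩 0) j =
      hilbertFun (F.gradedCocycles 𝒩 (m + 1)) j + hilbertFun (F.gradedCoboundaries 𝒩 m) (j + e) ∧
    hilbertFun (G.extGrading 𝒩 1) j =
      hilbertFun (F.extGrading 𝒩 (m + 2)) j - hilbertFun (F.extGrading 𝒩 m) (j + e) := by
  have hK := F.isGradedModule_pushoutGrading hA m hτ
  have hP := F.isGradedPresentation_cone hA m hτ hττ'
  have hG := G.isGradedPresentation hA hK
  have hPf0 := fun j => (F.hilbertFun_homDeg_cone hA hN hfin m e j).1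
  have hPf1 := fun j => (F.hilbertFun_homDeg_cone hA hN hfin (m + 1) e j).1
  have hGf := fun i j => G.finite_homGrading hA hN hfin i j
  -- Applying the comparison in both directions turns its inequalities into equalities, so the cone
  -- computes the Ext modules defined by `G`.
  have h1 := hP.finrank_le hG hK.isInternal hPf0 hPf1 (hGf 0) (hGf 1) j
  have h2 := hG.finrank_le hP hK.isInternal (hGf 0) (hGf 1) hPf0 hPf1 j
  have e0 := le_antisymm h1.1 h2.1
  have e1 := le_antisymm h1.2 h2.2
  have c0 := F.hilbertFun_ker_coneDiff hA hN hfin m hτ hinj j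
  have c1 := F.hilbertFun_ker_coneDiff hA hN hfin (m + 1) (τ := -τ') (e := e)
    (fun l v hv => neg_mem (hτ' l v hv)) (fun φ hφ => by
      rw [← hinj' φ hφ, LinearMap.comp_neg, neg_mem_iff]) j
  have := hPf0 j
  have b := finrank_map_add_inf_ker ((LinearMap.lcomp A N (F.coneDiff m τ)).restrictScalars k)
    (homDeg A (F.coneGrading m e) 𝒩 j)
  rw [map_eq_inf_range (F.isInternal_homDeg_cone hA hN m e)
    (F.isInternal_homDeg_cone hA hN (m + 1) e)
    ((LinearMap.lcomp A N (F.coneDiff m τ)).restrictScalars k)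
    (fun j φ hφ l v hv => hφ l _ (F.isGradedMap_coneDiff hA m hτ l v hv))] at b
  have b' : hilbertFun (part (homDeg A (F.coneGrading (m + 1) e) 𝒩)
      (LinearMap.range (LinearMap.lcomp A N (F.coneDiff m τ)))) j +
      hilbertFun (part (homDeg A (F.coneGrading m e) 𝒩)
        (LinearMap.ker (LinearMap.lcomp A N (F.coneDiff m τ)))) j =
      hilbertFun (homDeg A (F.coneGrading m e) 𝒩) j := by
    unfold hilbertFun
    exact_mod_cast b
  have g0 := G.hilbertFun_gradedCocycles hA hN hfin 0 j
  have g1 := G.hilbertFun_gradedCocycles hA hN hfin 1 j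
  rw [gradedCoboundaries_zero, add_zero] at g0
  have e0' : hilbertFun (G.gradedCocycles 𝒩 0) j = _ := e0
  have e1' : hilbertFun (G.gradedCocycles 𝒩 1) j + _ =
    _ + hilbertFun (G.gradedCoboundaries 𝒩 1) j := e1
  have f0 := (F.hilbertFun_homDeg_cone hA hN hfin m e j).2
  have f1 := F.hilbertFun_homGrading hA hN hfin (m + 1) j
  have f2 := F.hilbertFun_homGrading hA hN hfin m (j + e)
  have f3 := F.hilbertFun_gradedCocycles hA hN hfin (m + 2) j
  have f4 := F.hilbertFun_gradedCocycles hA hN hfin m (j + e)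
  -- In degree 1 the cone has cocycles Z^{m+2} + t^{-e} B^{m+1}. Its coboundaries are Hom of the
  -- degree-0 term minus the 0-cocycles, that is B^{m+2} + t^{-e} (Ext^m + B^{m+1}), and B^{m+1}
  -- cancels.
  refine ⟨by rw [← g0, e0', c0], by linarith⟩

end FreeResolution

theorem FreeResolution.map_mem_of_single_mem {k : Type*} [Field k] {A : Type*} [CommRing A]
    [Algebra k A] {𝒜 : ℤ → Submodule k A} {ι : Type*} {x : ι → A} {w : ι → ℤ} {M : Type*}
    [AddCommGroup M] [Module k M] [Module A M] {ℳ : ℤ → Submodule k M} (F : FreeResolution 𝒜 ℳ)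
    (hA : IsPosGraded 𝒜 x w) {i j : ℕ} (τ : F.Obj i →ₗ[A] F.Obj j) {d : ℤ}
    (h : ∀ q, τ (Pi.single q 1) ∈ freeGrading 𝒜 (F.deg j) (F.deg i q + d)) {l : ℤ} {v : F.Obj i}
    (hv : v ∈ freeGrading 𝒜 (F.deg i) l) : τ v ∈ freeGrading 𝒜 (F.deg j) (l + d) :=
  map_mem_of_single (isGradedModule_freeGrading hA (F.deg j)).smul_mem h hv

/-! ### Eisenbud operators -/

namespace EisenbudData

variable {k : Type*} [Field k] {ν c : ℕ} {w : Fin ν → ℤ} {f : Fin c → MvPolynomial (Fin ν) k}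
  {d : Fin c → ℤ} {M : Type*} [AddCommGroup M] [Module k M] [Module (QuotRing f) M]
  {ℳ : ℤ → Submodule k M} {F : FreeResolution (quotGrading w f) ℳ} (E : EisenbudData w f d F)

/-- Associativity of ∂̃∂̃∂̃ gives Σ f_m (∂̃τ̃^m - τ̃^m∂̃) = 0. Since f is regular, every entry of
each difference lies in the ideal (f), and therefore vanishes over R. -/
theorem diff_comp_op (hR : IsCompleteIntersection w f d) (m : Fin c) (j : ℕ) :
    F.diff j ∘ₗ E.op m (j + 1) = E.op m j ∘ₗ F.diff (j + 2) := by
  have h : F.d j * (E.tauLift m (j + 1)).map (Ideal.Quotient.mk (Ideal.span (Set.range f))) =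
      (E.tauLift m j).map (Ideal.Quotient.mk (Ideal.span (Set.range f))) * F.d (j + 2) := by
    rw [← E.dLift_map, ← E.dLift_map, ← Matrix.map_mul, ← Matrix.map_mul]
    ext p q
    rw [Matrix.map_apply, Matrix.map_apply, Ideal.Quotient.eq]
    refine hR.mem_span_of_sum_mul_eq_zero (fun m => (E.dLift j * E.tauLift m (j + 1)) p q -
      (E.tauLift m j * E.dLift (j + 2)) p q) ?_ m
    have h1 := Matrix.mul_assoc (E.dLift j) (E.dLift (j + 1)) (E.dLift (j + 2))
    have h2 := E.dLift_mul_dLift j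
    have h3 := E.dLift_mul_dLift (j + 1)
    rw [h2] at h1
    rw [show E.dLift (j + 1) * E.dLift (j + 2) = _ from h3, Matrix.sum_mul, Matrix.mul_sum] at h1
    have h4 := congrFun (congrFun h1 p) q
    simp only [Matrix.sum_apply, Matrix.smul_mul, Matrix.mul_smul, Matrix.smul_apply,
      smul_eq_mul] at h4
    simp only [mul_sub, Finset.sum_sub_distrib]
    rw [h4, sub_self]
  unfold op FreeResolution.diff
  rw [← Matrix.mulVecLin_mul, ← Matrix.mulVecLin_mul, h]

/-- The combinations of Eisenbud operators are chain maps. -/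
theorem diff_comp_comb (hR : IsCompleteIntersection w f d) (a : Fin c → QuotRing f) (j : ℕ) :
    F.diff j ∘ₗ E.comb a (j + 1) = E.comb a j ∘ₗ F.diff (j + 2) := by
  refine LinearMap.ext fun v => ?_
  simp only [comb, LinearMap.comp_apply, LinearMap.sum_apply, LinearMap.smul_apply, map_sum,
    map_smul]
  exact Finset.sum_congr rfl fun m _ =>
    congrArg (a m • ·) (LinearMap.congr_fun (E.diff_comp_op hR m j) v)

theorem comb_mem (hR : IsCompleteIntersection w f d) {e : ℤ} {a : Fin c → QuotRing f}
    (ha : ∀ m, a m ∈ quotGrading w f (d m - e)) (j : ℕ) (l : ℤ) (v : F.Obj (j + 2))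
    (hv : v ∈ freeGrading (quotGrading w f) (F.deg (j + 2)) l) :
    E.comb a j v ∈ freeGrading (quotGrading w f) (F.deg j) (l - e) := by
  have hA := hR.isPosGraded
  have h : ∀ q, E.comb a j (Pi.single q 1) ∈
      freeGrading (quotGrading w f) (F.deg j) (F.deg (j + 2) q + -e) := by
    intro q
    refine mem_freeGrading.2 fun p => ?_
    have h1 : E.comb a j (Pi.single q 1) p = ∑ m, a m *
        Ideal.Quotient.mk (Ideal.span (Set.range f)) (E.tauLift m j p q) := by
      simp only [comb, LinearMap.sum_apply, Finset.sum_apply, LinearMap.smul_apply, Pi.smul_apply,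
        smul_eq_mul, op, Matrix.mulVecLin_apply, Matrix.mulVec_single_one, Matrix.col_apply,
        Matrix.map_apply]
    rw [h1]
    refine Submodule.sum_mem _ fun m _ => ?_
    have h2 := hA.graded.smul_mem (ha m) (mk_mem_quotGrading (f := f) (E.tauLift_homogeneous m j p q))
    rwa [show d m - e + (F.deg (j + 2) q - d m - F.deg j p) =
      F.deg (j + 2) q + -e - F.deg j p by ring] at h2
  rw [sub_eq_add_neg]
  exact F.map_mem_of_single_mem hA (E.comb a j) h hv

/-- This is the well-definedness of χ on classes; with the non-zerodivisor hypothesis it gives the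
equivalence that the cone argument requires. -/
theorem comp_comb_mem_coboundaries {N : Type*} [AddCommGroup N] [Module (QuotRing f) N]
    (hR : IsCompleteIntersection w f d) (a : Fin c → QuotRing f) (j : ℕ)
    {φ : F.Obj j →ₗ[QuotRing f] N} (hφ : φ ∈ F.coboundaries N j) :
    φ ∘ₗ E.comb a j ∈ F.coboundaries N (j + 2) := by
  cases j with
  | zero =>
    rw [show φ = 0 from hφ, LinearMap.zero_comp]
    exact zero_mem _
  | succ j =>
    obtain ⟨ψ, rfl⟩ := hφ
    refine ⟨ψ ∘ₗ E.comb a j, ?_⟩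
    change (ψ ∘ₗ E.comb a j) ∘ₗ F.diff (j + 2) = (ψ ∘ₗ F.diff j) ∘ₗ E.comb a (j + 1)
    rw [LinearMap.comp_assoc, LinearMap.comp_assoc, E.diff_comp_comb hR]

end EisenbudData

/-! ### Rational Hilbert series -/

theorem HasRationalHilbertSeries.finite {k : Type*} [Field k] {M : Type*} [AddCommGroup M]
    [Module k M] {ℳ : ℤ → Submodule k M} (h : HasRationalHilbertSeries ℳ) (i : ℤ) :
    Module.Finite k (ℳ i) := by
  obtain ⟨φ, hφ⟩ := h
  exact hφ.1 i

theorem hilbertSeries_ne_zero {k : Type*} [Field k] {A : Type*} [CommRing A] [Nontrivial A]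
    [Algebra k A] {𝒜 : ℤ → Submodule k A} (h : HasRationalHilbertSeries 𝒜)
    (h1 : (1 : A) ∈ 𝒜 0) : hilbertSeries 𝒜 ≠ 0 := by
  intro h0
  have h2 := h.isGenFun 0
  rw [h0, map_zero, HahnSeries.coeff_zero] at h2
  have := h.finite 0
  have h3 : Module.finrank k (𝒜 0) = 0 := by
    unfold hilbertFun at h2
    exact_mod_cast h2.symm
  have h4 := Submodule.finrank_eq_zero.1 h3
  rw [h4, Submodule.mem_bot] at h1
  exact one_ne_zero h1

/-! ### Rationality of the series of Ext and syzygies, and the telescoping of ρ -/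

namespace FreeResolution

variable {k : Type*} [Field k] {A : Type*} [CommRing A] [Algebra k A] {𝒜 : ℤ → Submodule k A}
  {ι : Type*} {x : ι → A} {w : ι → ℤ}
  {M : Type*} [AddCommGroup M] [Module k M] [Module A M]
  {ℳ : ℤ → Submodule k M}
  {N : Type*} [AddCommGroup N] [Module k N] [Module A N] [IsScalarTower k A N]
  {𝒩 : ℤ → Submodule k N} (F : FreeResolution 𝒜 ℳ)

/-- In positive degrees the coboundaries are Hom(F_i, N) modulo the cocycles, so rationality follows
by subtraction. -/
theorem exists_isGenFun_gradedCoboundaries [Fintype ι] [IsNoetherianRing A] [Module.Finite A N]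
    (hA : IsPosGraded 𝒜 x w) (hN : IsGradedModule 𝒜 𝒩) (i : ℕ) :
    ∃ φ, IsGenFun φ (hilbertFun (F.gradedCoboundaries 𝒩 i)) := by
  have hHN := hA.hasRationalHilbertSeries hN
  cases i with
  | zero => exact ⟨0, IsGenFun.zero.congr fun i => (F.gradedCoboundaries_zero i).symm⟩
  | succ i =>
    obtain ⟨φ, hφ⟩ := F.exists_isGenFun_gradedCocycles hA hN i
    refine ⟨_, ((isGenFun_homDeg hA hN hHN.finite (F.deg i) hHN.isGenFun).sub hφ).congr
      fun j => ?_⟩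
    have : hilbertFun (homDeg A (freeGrading 𝒜 (F.deg i)) 𝒩) j = _ :=
      F.hilbertFun_homGrading hA hN hHN.finite i j
    rw [this]
    ring

theorem hasRationalHilbertSeries_extGrading [Fintype ι] [IsNoetherianRing A] [Module.Finite A N]
    (hA : IsPosGraded 𝒜 x w) (hN : IsGradedModule 𝒜 𝒩) (i : ℕ) :
    HasRationalHilbertSeries (F.extGrading 𝒩 i) := by
  have hHN := hA.hasRationalHilbertSeries hN
  obtain ⟨φ, hφ⟩ := F.exists_isGenFun_gradedCocycles hA hN i
  obtain ⟨ψ, hψ⟩ := F.exists_isGenFun_gradedCoboundaries hA hN i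
  refine ⟨φ - ψ, F.finite_extGrading hA hN hHN.finite i, (hφ.sub hψ).congr fun j => ?_⟩
  rw [F.hilbertFun_gradedCocycles hA hN hHN.finite i j]
  exact add_sub_cancel_right _ _

theorem exists_isGenFun_bdry (hA : IsPosGraded 𝒜 x w) [IsScalarTower k A M]
    (hM : IsGradedModule 𝒜 ℳ) (hHA : HasRationalHilbertSeries 𝒜)
    (hHM : HasRationalHilbertSeries ℳ) (i : ℕ) :
    ∃ φ, IsGenFun φ (hilbertFun (F.bdry i)) := by
  induction i with
  | zero =>
    refine ⟨_, ((isGenFun_freeGrading hHA.finite (F.deg 0) hHA.isGenFun).sub hHM.isGenFun).congr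
      fun j => ?_⟩
    rw [F.hilbertFun_freeGrading_zero hA hHA.finite hM]
    ring
  | succ i ih =>
    obtain ⟨φ, hφ⟩ := ih
    refine ⟨_, ((isGenFun_freeGrading hHA.finite (F.deg (i + 1)) hHA.isGenFun).sub hφ).congr
      fun j => ?_⟩
    rw [F.hilbertFun_freeGrading_succ hA hHA.finite]
    ring

/-- The partial Euler characteristics in terms of the syzygies and the coboundaries: the series
`ρ^n(M, N)` is `(-1)^n (φ(Syz_{n+1}, N) - H(B^{n+1}, t))`. -/
theorem rho_eq [Fintype ι] [IsNoetherianRing A] [Module.Finite A N]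
    [IsScalarTower k A M] (hA : IsPosGraded 𝒜 x w) (hM : IsGradedModule 𝒜 ℳ)
    (hN : IsGradedModule 𝒜 𝒩) (hHA : HasRationalHilbertSeries 𝒜)
    (hHM : HasRationalHilbertSeries ℳ) (hne : invVar (hilbertSeries 𝒜) ≠ 0)
    {β γ : ℕ → RatFunc ℚ} (hβ : ∀ i, IsGenFun (β i) (hilbertFun (F.bdry i)))
    (hγ : ∀ i, IsGenFun (γ i) (hilbertFun (F.gradedCoboundaries 𝒩 i))) (n : ℕ) :
    F.rho 𝒩 n = (-1) ^ n * (invVarHom (β n) * hilbertSeries 𝒩 / invVar (hilbertSeries 𝒜) -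
      γ (n + 1)) := by
  have hHN := hA.hasRationalHilbertSeries hN
  have hE := F.hasRationalHilbertSeries_extGrading hA hN
  have hP0 : degPoly (F.deg 0) * hilbertSeries 𝒜 = hilbertSeries ℳ + β 0 :=
    (isGenFun_freeGrading hHA.finite (F.deg 0) hHA.isGenFun).unique
      ((hHM.isGenFun.add (hβ 0)).congr fun j =>
        (F.hilbertFun_freeGrading_zero hA hHA.finite hM j).symm)
  have hP : ∀ i, degPoly (F.deg (i + 1)) * hilbertSeries 𝒜 = β i + β (i + 1) := fun i =>
    (isGenFun_freeGrading hHA.finite (F.deg (i + 1)) hHA.isGenFun).unique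
      (((hβ i).add (hβ (i + 1))).congr fun j =>
        (F.hilbertFun_freeGrading_succ hA hHA.finite i j).symm)
  have hH : ∀ i, invVarHom (degPoly (F.deg i)) * hilbertSeries 𝒩 =
      hilbertSeries (F.extGrading 𝒩 i) + γ i + γ (i + 1) := fun i =>
    (isGenFun_homDeg hA hN hHN.finite (F.deg i) hHN.isGenFun).unique
      ((((hE i).isGenFun.add (hγ i)).add (hγ (i + 1))).congr fun j => by
        rw [← F.hilbertFun_gradedCocycles hA hN hHN.finite i j]
        exact (F.hilbertFun_homGrading hA hN hHN.finite i j).symm)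
  have hγ0 : γ 0 = 0 := (hγ 0).unique
    (IsGenFun.zero.congr fun i => (F.gradedCoboundaries_zero i).symm)
  -- Multiplication by κ after t ↦ t⁻¹ turns H(F_i) into H(Hom(F_i, N)). The relations between the
  -- H(F_i) and the β_i can thus be subtracted from those for Hom.
  set κ := hilbertSeries 𝒩 / invVar (hilbertSeries 𝒜) with hκ
  have hκ' : invVar (hilbertSeries 𝒜) * κ = hilbertSeries 𝒩 := mul_div_cancel₀ _ hne
  rw [mul_div_assoc, ← hκ]
  induction n with
  | zero =>
    have h1 := congrArg invVarHom hP0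
    rw [map_mul, map_add, invVarHom_apply (hilbertSeries 𝒜), invVarHom_apply (hilbertSeries ℳ)] at h1
    have h2 := hH 0
    rw [hγ0, ← hκ', ← mul_assoc, h1] at h2
    simp only [rho, phi, zero_add, Finset.sum_range_one, pow_zero, one_mul]
    rw [mul_div_assoc, ← hκ]
    linear_combination -h2
  | succ n ih =>
    have h1 := congrArg invVarHom (hP n)
    rw [map_mul, map_add, invVarHom_apply (hilbertSeries 𝒜)] at h1
    have h2 := hH (n + 1)
    rw [← hκ', ← mul_assoc, h1] at h2
    have h3 : F.rho 𝒩 (n + 1) =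
        F.rho 𝒩 n + (-1) ^ (n + 1) * hilbertSeries (F.extGrading 𝒩 (n + 1)) := by
      simp only [rho, Finset.sum_range_succ _ (n + 1)]
      ring
    rw [h3, ih, pow_succ]
    linear_combination (-1) ^ n * h2

theorem rho_one : F.rho 𝒩 1 = hilbertSeries (F.extGrading 𝒩 0) -
    hilbertSeries (F.extGrading 𝒩 1) -
      invVar (hilbertSeries ℳ) * (hilbertSeries 𝒩 / invVar (hilbertSeries 𝒜)) := by
  rw [rho, phi, Finset.sum_range_succ, Finset.sum_range_one, mul_div_assoc]
  ring

/-- The final algebra in isolation: s = (-1)^n, t stands for t^{-e}, h = H(N), r = H(R, t⁻¹), p =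
P_n(t⁻¹), b = β_n(t⁻¹), while g, g₁ are γ_n, γ_{n+1} and E, E₁, E₂ the series of Ext^n, Ext^{n+1},
Ext^{n+2}. -/
theorem rho_identity {R : Type*} [CommRing R] {s h r κ t p b E E₁ E₂ g g₁ : R} (hκ : r * κ = h)
    (hp : p * h = E + g + g₁) (hs : s * s = 1) :
    E₁ + g₁ + t * g - (E₂ - t * E) - (b + t * (p * r - b)) * κ =
      s * (t - 1) * (s * (b * κ - g₁)) + E₁ - E₂ := by
  linear_combination (-t) * hp - t * p * hκ - (t - 1) * (b * κ - g₁) * hs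

/-- The series `ρ^1(K, N)` of the pushout `K` along a chain map `τ` of degree `-e` that is injective
on `Ext^n` and on `Ext^{n+1}`. -/
theorem rho_pushout [Fintype ι] [IsNoetherianRing A] [Nontrivial A] [Module.Finite A M]
    [Module.Finite A N] [IsScalarTower k A M] (hA : IsPosGraded 𝒜 x w) (hM : IsGradedModule 𝒜 ℳ)
    (hN : IsGradedModule 𝒜 𝒩) {e : ℤ} {τ : ∀ j, F.Obj (j + 2) →ₗ[A] F.Obj j}
    (hτ : ∀ j l, ∀ v ∈ freeGrading 𝒜 (F.deg (j + 2)) l, τ j v ∈ freeGrading 𝒜 (F.deg j) (l - e))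
    (hτc : ∀ j, F.diff j ∘ₗ τ (j + 1) = τ j ∘ₗ F.diff (j + 2)) (n : ℕ)
    (hinj : ∀ j, n ≤ j → ∀ φ ∈ F.cocycles N j,
      φ ∘ₗ τ j ∈ F.coboundaries N (j + 2) ↔ φ ∈ F.coboundaries N j)
    (G : FreeResolution 𝒜 (F.pushoutGrading n (τ n) e)) :
    HasRationalHilbertSeries (F.pushoutGrading n (τ n) e) ∧
    G.rho 𝒩 1 = (-1) ^ n * ((RatFunc.X : RatFunc ℚ) ^ (-e) - 1) * F.rho 𝒩 n +
      hilbertSeries (F.extGrading 𝒩 (n + 1)) - hilbertSeries (F.extGrading 𝒩 (n + 2)) := by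
  have hHA : HasRationalHilbertSeries 𝒜 := hA.hasRationalHilbertSeries hA.graded
  have hHM := hA.hasRationalHilbertSeries hM
  have hHN := hA.hasRationalHilbertSeries hN
  have hFE := F.hasRationalHilbertSeries_extGrading hA hN
  have hGE := G.hasRationalHilbertSeries_extGrading hA hN
  choose β hβ using F.exists_isGenFun_bdry hA hM hHA hHM
  choose γ hγ using F.exists_isGenFun_gradedCoboundaries (𝒩 := 𝒩) hA hN
  have hKfun := F.hilbertFun_pushoutGrading hA hHA.finite n (hτ n) (hτc n)
  have hKgen := ((hβ n).add (((isGenFun_freeGrading hHA.finite (F.deg n) hHA.isGenFun).shift e).sub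
    ((hβ n).shift e))).congr fun j => (hKfun j).symm
  have hHK : HasRationalHilbertSeries (F.pushoutGrading n (τ n) e) :=
    ⟨_, F.finite_pushoutGrading hHA.finite n _, hKgen⟩
  refine ⟨hHK, ?_⟩
  have hne : invVar (hilbertSeries 𝒜) ≠ 0 := by
    rw [← invVarHom_apply]
    exact (map_ne_zero invVarHom).2 (hilbertSeries_ne_zero hHA hA.one_mem)
  rw [F.rho_eq hA hM hN hHA hHM hne hβ hγ n]
  have hext := F.hilbertFun_extGrading_pushout hA hN hHN.finite n (hτ n) (hinj n le_rfl)
    (hτ (n + 1)) (hinj (n + 1) n.le_succ) (hτc n) G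
  have hH : ∀ i, invVarHom (degPoly (F.deg i)) * hilbertSeries 𝒩 =
      hilbertSeries (F.extGrading 𝒩 i) + γ i + γ (i + 1) := fun i =>
    (isGenFun_homDeg hA hN hHN.finite (F.deg i) hHN.isGenFun).unique
      ((((hFE i).isGenFun.add (hγ i)).add (hγ (i + 1))).congr fun j => by
        rw [← F.hilbertFun_gradedCocycles hA hN hHN.finite i j]
        exact (F.hilbertFun_homGrading hA hN hHN.finite i j).symm)
  have hE0 : hilbertSeries (G.extGrading 𝒩 0) = hilbertSeries (F.extGrading 𝒩 (n + 1)) +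
      γ (n + 1) + RatFunc.X ^ (-e) * γ n :=
    (hGE 0).isGenFun.unique ((((hFE (n + 1)).isGenFun.add (hγ (n + 1))).add
      ((hγ n).shift (-e))).congr fun j => by
        rw [(hext j).1, F.hilbertFun_gradedCocycles hA hN hHN.finite, sub_neg_eq_add])
  have hE1 : hilbertSeries (G.extGrading 𝒩 1) = hilbertSeries (F.extGrading 𝒩 (n + 2)) -
      RatFunc.X ^ (-e) * hilbertSeries (F.extGrading 𝒩 n) :=
    (hGE 1).isGenFun.unique (((hFE (n + 2)).isGenFun.sub
      ((hFE n).isGenFun.shift (-e))).congr fun j => by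
        rw [(hext j).2, sub_neg_eq_add])
  -- The shift t^e in H(K, t) becomes t^{-e} here, matching the shifts in the Ext modules of K.
  have hK : invVar (hilbertSeries (F.pushoutGrading n (τ n) e)) = invVarHom (β n) +
      RatFunc.X ^ (-e) * (invVarHom (degPoly (F.deg n)) *
        invVar (hilbertSeries 𝒜) - invVarHom (β n)) := by
    rw [hHK.isGenFun.unique hKgen, ← invVarHom_apply, ← invVarHom_apply]
    simp only [map_add, map_sub, map_mul, invVarHom_zpow_X]
    ring
  have h2 := hH n
  rw [G.rho_one, hE0, hE1, hK, mul_div_assoc]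
  exact rho_identity (mul_div_cancel₀ _ hne) h2 (by rw [← mul_pow]; simp)

end FreeResolution

end GradedExt

end

theorem proposition3p3
    {k : Type*} [Field k] [Infinite k] {ν c : ℕ}
    (w : Fin ν → ℤ) (f : Fin c → MvPolynomial (Fin ν) k) (d : Fin c → ℤ)
    (hR : GradedExt.IsCompleteIntersection w f d)
    {M N : Type*}
    [AddCommGroup M] [Module k M] [Module (GradedExt.QuotRing f) M]
    [IsScalarTower k (GradedExt.QuotRing f) M] [Module.Finite (GradedExt.QuotRing f) M]
    [AddCommGroup N] [Module k N] [Module (GradedExt.QuotRing f) N]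
    [IsScalarTower k (GradedExt.QuotRing f) N] [Module.Finite (GradedExt.QuotRing f) N]
    (ℳ : ℤ → Submodule k M) (𝒩 : ℤ → Submodule k N)
    (hM : GradedExt.IsGradedModule (GradedExt.quotGrading w f) ℳ)
    (hN : GradedExt.IsGradedModule (GradedExt.quotGrading w f) 𝒩)
    -- a minimal graded free resolution of `M`, with a choice of Eisenbud operators
    (F : GradedExt.FreeResolution (GradedExt.quotGrading w f) ℳ)
    (hF : F.IsMinimal (GradedExt.irrelevantIdeal f))
    (E : GradedExt.EisenbudData w f d F)
    (hfext : F.fext N < ⊤) (hcx : 0 < F.complexity N)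
    -- `χ = ∑ m, a m * χ_m`, of bidegree `(2, -e)`, is a non-zerodivisor on `Ext^{≥ s}(M, N)`
    (e s : ℕ) (a : Fin c → GradedExt.QuotRing f)
    (ha : ∀ m, a m ∈ GradedExt.quotGrading w f (d m - e))
    (hχ : F.IsNonzerodivisorFrom N (E.comb a) s)
    -- the convention on `s` in the case of complexity one
    (hs : F.complexity N = 1 → ∀ i, s ≤ i → F.extLength N i = F.extLength N (i + 2))
    (n : ℕ) (hns : s < n) (hnl : F.fext N < (n : EReal))
    -- any graded free resolution of the pushout `K`
    (G : GradedExt.FreeResolution (GradedExt.quotGrading w f)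
      (F.pushoutGrading n (E.comb a n) e)) :
    -- the Hilbert series involved are rational functions
    (GradedExt.HasRationalHilbertSeries (GradedExt.quotGrading w f) ∧
      GradedExt.HasRationalHilbertSeries ℳ ∧
      GradedExt.HasRationalHilbertSeries 𝒩 ∧
      GradedExt.HasRationalHilbertSeries (F.pushoutGrading n (E.comb a n) e) ∧
      (∀ i, GradedExt.HasRationalHilbertSeries (F.extGrading 𝒩 i)) ∧
      (∀ i, GradedExt.HasRationalHilbertSeries (G.extGrading 𝒩 i))) ∧
    G.rho 𝒩 1 =
      (-1) ^ n * ((RatFunc.X : RatFunc ℚ) ^ (-(e : ℤ)) - 1) * F.rho 𝒩 n +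
        GradedExt.hilbertSeries (F.extGrading 𝒩 (n + 1)) -
        GradedExt.hilbertSeries (F.extGrading 𝒩 (n + 2)) := by
  have hA := hR.isPosGraded
  have := hR.nontrivial_quotRing
  have h := F.rho_pushout hA hM hN (E.comb_mem hR ha) (E.diff_comp_comb hR a) n
    -- Since s < n, the map χ is injective on Ext^j for all j ≥ n; the argument uses j = n and j = n
    -- + 1.
    (fun j hj φ hφ => ⟨hχ j (hns.le.trans hj) φ hφ, E.comp_comb_mem_coboundaries hR a j⟩) G
  exact ⟨⟨hA.hasRationalHilbertSeries hA.graded, hA.hasRationalHilbertSeries hM,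
    hA.hasRationalHilbertSeries hN, h.1, F.hasRationalHilbertSeries_extGrading hA hN,
    G.hasRationalHilbertSeries_extGrading hA hN⟩, h.2⟩
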